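/- Subsets of $\omega=\{0,1,2,\dots\}$ are called sets. For sets $X,Y$ let $\overline{X}=\omega\setminus X$ and $X\oplus Y=\{2n:n\in X\}\cup\{2n+1:n\in Y\}$. A binary tree is a set $T\subseteq 2^{<\omega}$ closed under initial segments, and a path through $T$ is an $f\in 2^\omega$ all of whose finite initial segments belong to $T$. A set $X$ is of PA-degree if every infinite computable binary tree has a path that is computable from $X$ (equivalently, if $X$ computes a completion of Peano arithmetic; equivalently, if $X$ computes a $\{0,1\}$-valued diagonally non-recursive function). Theorem 1.4. For any set $C$ that is not of PA-degree and any set $A$, there exists an infinite set $G$ with $G\subseteq A$ or $G\subseteq\overline{A}$ such that $G\oplus C$ is not of PA-degree. -/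

import Mathlib

/-- The characteristic function of a set of natural numbers, with values in `{0, 1}`. -/
noncomputable def charFun (X : Set ℕ) : ℕ → ℕ :=
  X.indicator fun _ => 1

/-- A function `f` is computable from the set `X`: it is computable with the characteristic
function of `X` as an oracle. -/
def ComputableFromSet {α σ : Type*} [Primcodable α] [Primcodable σ] (X : Set ℕ) (f : α → σ) :
    Prop :=
  ComputableIn {fun n => Part.some (charFun X n)} f

/-- The join `X ⊕ Y = {2n : n ∈ X} ∪ {2n + 1 : n ∈ Y}` of two sets of natural numbers. -/
def setJoin (X Y : Set ℕ) : Set ℕ :=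
  (fun n => 2 * n) '' X ∪ (fun n => 2 * n + 1) '' Y

/-- A binary tree: a set of finite `{0,1}`-strings that is closed under initial segments. -/
def IsBinaryTree (T : Set (List Bool)) : Prop :=
  ∀ σ τ : List Bool, σ <+: τ → τ ∈ T → σ ∈ T

/-- `f` is an infinite path through `T`: every finite initial segment
`f 0, …, f (n - 1)` of `f` is in `T`. -/
def IsPathThrough (f : ℕ → Bool) (T : Set (List Bool)) : Prop :=
  ∀ n : ℕ, (List.range n).map f ∈ T

/-- `X` is of PA-degree (in symbols `X ≫ 0`): every infinite computable binary tree has an infinite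
path that is computable from `X`. -/
def IsOfPADegree (X : Set ℕ) : Prop :=
  ∀ T : Set (List Bool), IsBinaryTree T → T.Infinite → ComputablePred (fun σ => σ ∈ T) →
    ∃ f : ℕ → Bool, IsPathThrough f T ∧ ComputableFromSet X f

/-! PA-degree is tested by avoidance. A set of PA-degree computes, for each partial computable
{0,1}-valued `V`, a total function that nowhere agrees with `V` (`IsOfPADegree.exists_avoids`). As
`C` is not of PA-degree, some fixed `V` is avoided by no `C`-computable function
(`exists_graph_of_not_isOfPADegree`). It suffices to build `G` on one side of `A` so that every
functional with oracle `G ⊕ C` agrees with `V` somewhere or diverges somewhere.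

The construction is a forcing. A condition is a nonempty class of finite colourings, closed
effectively in `C`, with two finite stems per colour, one inside `A` and one outside. `A` enters
only through the stems, so the classes stay effective in `C` for arbitrary `A`. Requirements are
treated in pairs, one per side, and each colour has to satisfy one member of the pair.

Given a pair, let `W` hold of a finite list of (argument, value) pairs if, for every colouring in
the class and every splitting of its colours into two sides, the stem of some unsettled colour
extends so that the functional outputs a listed value. By compactness `W` is enumerable in `C`
(`REIn.forall_colouring`). By `exists_correct_or_forall_not_mem`, either `W` contains a list of
correct values of `V`, and splitting by `A` itself yields a stem extension forcing agreement; or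
there are K arguments all of whose 2^K valuations fail `W`. In the latter case each valuation has a
split colouring as counterexample. These are superposed; by pigeonhole each new colour has two
valuations giving the same old colour and side. They differ at some argument, where both values are
thereby excluded, so divergence is forced.

König's lemma selects a coherent sequence of colours that can occur infinitely often. If each side
failed a requirement, the two failures would form a pair already treated, so one side satisfies all
of them. Infinitude of `G` is itself obtained from requirements. -/

open Encodable

/-! ### Closure properties of recursively enumerable predicates. -/

/-- Step-bounded evaluation is primitive recursive; its monotonicity lets several searches share one
stage. -/
theorem REPred.exists_primrec_kernel {α : Type*} [Primcodable α] {p : α → Prop} (hp : REPred p) :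
    ∃ M : α → ℕ → Bool, Primrec₂ M ∧ (∀ a s t, s ≤ t → M a s = true → M a t = true) ∧
      ∀ a, p a ↔ ∃ s, M a s = true := by
  obtain ⟨c, hc⟩ := Nat.Partrec.Code.exists_code.1 hp
  refine ⟨fun a s => (Nat.Partrec.Code.evaln s c (encode a)).isSome, ?_, ?_, ?_⟩
  · exact Primrec.option_isSome.comp
      (Nat.Partrec.Code.primrec_evaln.comp
        ((Primrec.snd.pair (Primrec.const c)).pair (Primrec.encode.comp Primrec.fst)))
  · intro a s t hst h
    obtain ⟨x, hx⟩ := Option.isSome_iff_exists.1 h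
    exact Option.isSome_iff_exists.2 ⟨x, Nat.Partrec.Code.evaln_mono hst hx⟩
  · intro a
    have h1 : p a ↔ (c.eval (encode a)).Dom := by
      rw [hc]; simp [Part.assert]
    rw [h1, Part.dom_iff_mem]
    simp only [Option.isSome_iff_exists, Nat.Partrec.Code.evaln_complete, Option.mem_def]
    exact exists_comm

theorem REPred.exists_nat_of_computable {α : Type*} [Primcodable α] {M : α → ℕ → Bool}
    (hM : Computable₂ M) : REPred fun a => ∃ s, M a s = true := by
  have h : Partrec fun a => Nat.rfind fun n => Part.some (M a n) := Partrec.rfind hM.partrec₂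
  refine h.dom_re.of_eq fun a => ?_
  refine Nat.rfind_dom.trans ⟨?_, ?_⟩
  · rintro ⟨n, hn, -⟩
    exact ⟨n, (Part.mem_some_iff.1 hn).symm⟩
  · rintro ⟨n, hn⟩
    exact ⟨n, Part.mem_some_iff.2 hn.symm, fun _ => trivial⟩

theorem REPred.comp {α β : Type*} [Primcodable α] [Primcodable β] {p : β → Prop} (hp : REPred p)
    {f : α → β} (hf : Computable f) : REPred fun a => p (f a) :=
  Partrec.comp hp hf

theorem REPred.of_computable_bool {α : Type*} [Primcodable α] {f : α → Bool} (hf : Computable f) :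
    REPred fun a => f a = true :=
  (ComputablePred.computable_iff.2 ⟨f, hf, rfl⟩).to_re

theorem REPred.exists_snd {α β : Type*} [Primcodable α] [Primcodable β] {p : α → β → Prop}
    (hp : REPred fun x : α × β => p x.1 x.2) : REPred fun a => ∃ b, p a b := by
  obtain ⟨M, hM, -, hpM⟩ := hp.exists_primrec_kernel
  have : Computable₂ fun (a : α) (n : ℕ) =>
      ((decode (α := β × ℕ) n).bind fun b => some (M (a, b.1) b.2)).getD false := by
    refine Primrec.to_comp (Primrec.option_getD.comp (Primrec.option_bind
      (Primrec.decode.comp Primrec.snd) ?_) (Primrec.const false))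
    exact Primrec.option_some.comp (hM.comp ((Primrec.fst.comp Primrec.fst).pair
      (Primrec.fst.comp Primrec.snd)) (Primrec.snd.comp Primrec.snd))
  refine (REPred.exists_nat_of_computable this).of_eq fun a => ?_
  constructor
  · rintro ⟨n, hn⟩
    cases h : decode (α := β × ℕ) n with
    | none => simp [h] at hn
    | some b => exact ⟨b.1, (hpM (a, b.1)).2 ⟨b.2, by simpa [h] using hn⟩⟩
  · rintro ⟨b, hb⟩
    obtain ⟨s, hs⟩ := (hpM (a, b)).1 hb
    exact ⟨encode (b, s), by simp [encodek, hs]⟩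

theorem REPred.and {α : Type*} [Primcodable α] {p q : α → Prop} (hp : REPred p) (hq : REPred q) :
    REPred fun a => p a ∧ q a := by
  obtain ⟨M, hM, hmM, hpM⟩ := hp.exists_primrec_kernel
  obtain ⟨N, hN, hmN, hqN⟩ := hq.exists_primrec_kernel
  refine (REPred.exists_nat_of_computable (M := fun a s => M a s && N a s)
    (Primrec.and.comp hM hN).to_comp).of_eq fun a => ?_
  rw [hpM, hqN]
  constructor
  · rintro ⟨s, hs⟩
    rw [Bool.and_eq_true] at hs
    exact ⟨⟨s, hs.1⟩, ⟨s, hs.2⟩⟩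
  · rintro ⟨⟨s, hs⟩, ⟨t, ht⟩⟩
    exact ⟨max s t, by simp [hmM a s _ (le_max_left s t) hs, hmN a t _ (le_max_right s t) ht]⟩

theorem REPred.or {α : Type*} [Primcodable α] {p q : α → Prop} (hp : REPred p) (hq : REPred q) :
    REPred fun a => p a ∨ q a := by
  obtain ⟨M, hM, -, hpM⟩ := hp.exists_primrec_kernel
  obtain ⟨N, hN, -, hqN⟩ := hq.exists_primrec_kernel
  refine (REPred.exists_nat_of_computable (M := fun a s => M a s || N a s)
    (Primrec.or.comp hM hN).to_comp).of_eq fun a => ?_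
  rw [hpM, hqN, ← exists_or]
  simp

theorem REPred.forall_mem_list {α β : Type*} [Primcodable α] [Primcodable β] {p : α → β → Prop}
    (hp : REPred fun x : α × β => p x.1 x.2) {l : α → List β} (hl : Computable l) :
    REPred fun a => ∀ b ∈ l a, p a b := by
  obtain ⟨M, hM, hmM, hpM⟩ := hp.exists_primrec_kernel
  have key : REPred fun x : α × List β => ∀ b ∈ x.2, p x.1 b := by
    have h2 : Primrec₂ fun (x : α × List β) (s : ℕ) =>
        decide (∀ b ∈ x.2, M (x.1, b) s = true) := by
      have hR : PrimrecRel fun (b : β) (y : α × ℕ) => M (y.1, b) y.2 = true := by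
        refine ⟨inferInstance, ?_⟩
        simp only [Bool.decide_eq_true]
        exact hM.comp ((Primrec.fst.comp Primrec.snd).pair Primrec.fst)
          (Primrec.snd.comp Primrec.snd)
      have := (hR.forall_mem_list).comp
        (Primrec.snd.comp (Primrec.fst (α := α × List β) (β := ℕ)))
        ((Primrec.fst.comp Primrec.fst).pair Primrec.snd)
      obtain ⟨_, h⟩ := this
      exact h.of_eq fun x => by congr
    refine (REPred.exists_nat_of_computable h2.to_comp).of_eq fun x => ?_
    simp only [decide_eq_true_eq]
    constructor
    · rintro ⟨s, hs⟩ b hb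
      exact (hpM (x.1, b)).2 ⟨s, hs b hb⟩
    · intro h
      have : ∀ b ∈ x.2, ∃ s, M (x.1, b) s = true := fun b hb => (hpM (x.1, b)).1 (h b hb)
      obtain ⟨a, L⟩ := x
      simp only at this ⊢
      clear h
      induction L with
      | nil => exact ⟨0, by simp⟩
      | cons b L ih =>
        obtain ⟨s, hs⟩ := ih fun b hb => this b (List.mem_cons_of_mem _ hb)
        obtain ⟨t, ht⟩ := this b List.mem_cons_self
        refine ⟨max s t, fun b' hb' => ?_⟩
        rcases List.mem_cons.1 hb' with rfl | hb'
        · exact hmM _ _ _ (le_max_right s t) ht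
        · exact hmM _ _ _ (le_max_left s t) (hs b' hb')
  exact key.comp (Computable.id.pair hl)

theorem REPred.const_false {α : Type*} [Primcodable α] : REPred fun _ : α => False :=
  (REPred.of_computable_bool (Computable.const Bool.false)).of_eq fun _ => by simp

theorem REPred.exists_finite {α ι : Type*} [Primcodable α] [Finite ι] {p : ι → α → Prop}
    (hp : ∀ i, REPred (p i)) : REPred fun a => ∃ i, p i a := by
  have key : ∀ l : List ι, REPred fun a => ∃ i ∈ l, p i a := by
    intro l
    induction l with
    | nil => exact REPred.const_false.of_eq fun a => by simp
    | cons i l ih => exact ((hp i).or ih).of_eq fun a => by simp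
  obtain ⟨l, hl⟩ := Finite.exists_univ_list ι
  exact (key l).of_eq fun a => by simp [hl.2]

/-- Lets all pairs of requirements be arranged in one sequence. -/
theorem REPred.countable {α : Type*} [Primcodable α] :
    Countable {p : α → Prop // REPred p} := by
  have : ∀ p : {p : α → Prop // REPred p}, ∃ c : Nat.Partrec.Code,
      ∀ a, p.1 a ↔ (c.eval (encode a)).Dom := by
    rintro ⟨p, hp⟩
    obtain ⟨c, hc⟩ := Nat.Partrec.Code.exists_code.1 hp
    exact ⟨c, fun a => by rw [hc]; simp [Part.assert]⟩
  choose F hF using this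
  refine Function.Injective.countable (f := F) fun p q h => ?_
  ext a
  rw [hF p, hF q, h]

/-! ### Initial segments and characteristic functions. -/

/-- The initial segment `f 0, …, f (n - 1)` of `f`. -/
def initSeg {β : Type*} (f : ℕ → β) (n : ℕ) : List β :=
  (List.range n).map f

@[simp]
theorem length_initSeg {β : Type*} (f : ℕ → β) (n : ℕ) : (initSeg f n).length = n := by
  simp [initSeg]

theorem initSeg_succ {β : Type*} (f : ℕ → β) (n : ℕ) :
    initSeg f (n + 1) = initSeg f n ++ [f n] := by
  simp [initSeg, List.range_succ]

theorem getElem?_initSeg {β : Type*} (f : ℕ → β) (n x : ℕ) :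
    (initSeg f n)[x]? = if x < n then some (f x) else none := by
  unfold initSeg
  split_ifs with h <;> simp [h]

theorem map_initSeg {β γ : Type*} (g : β → γ) (f : ℕ → β) (n : ℕ) :
    (initSeg f n).map g = initSeg (g ∘ f) n := by
  simp [initSeg]

theorem take_initSeg {β : Type*} (f : ℕ → β) {m n : ℕ} (h : m ≤ n) :
    (initSeg f n).take m = initSeg f m := by
  simp [initSeg, ← List.map_take, List.take_range, h]

theorem initSeg_congr {β : Type*} {f g : ℕ → β} {n : ℕ} (h : ∀ x < n, f x = g x) :
    initSeg f n = initSeg g n :=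
  List.map_congr_left fun x hx => h x (List.mem_range.1 hx)

theorem eq_of_initSeg_eq {β : Type*} {f g : ℕ → β} {n : ℕ} (h : initSeg f n = initSeg g n)
    {x : ℕ} (hx : x < n) : f x = g x :=
  List.map_inj_left.1 h x (List.mem_range.2 hx)

/-- The Boolean characteristic function of a set of natural numbers. -/
noncomputable def boolInd (X : Set ℕ) : ℕ → Bool :=
  fun n => @decide (n ∈ X) (Classical.propDecidable _)

@[simp]
theorem boolInd_eq_true {X : Set ℕ} {n : ℕ} : boolInd X n = true ↔ n ∈ X := by
  simp [boolInd]

theorem charFun_eq_encode (X : Set ℕ) (n : ℕ) : charFun X n = encode (boolInd X n) := by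
  by_cases h : n ∈ X <;> simp [charFun, boolInd, h]

/-! ### Total functions recursive in an oracle. -/

/-- Total functions on the natural numbers that are recursive in `O`. -/
def TotalRecIn (O : Set (ℕ →. ℕ)) (f : ℕ → ℕ) : Prop :=
  Nat.RecursiveIn O fun n => Part.some (f n)

namespace TotalRecIn

variable {O : Set (ℕ →. ℕ)} {f g h : ℕ → ℕ}

theorem of_computable (hf : Computable f) : TotalRecIn O f :=
  Nat.Partrec.recursiveIn (Partrec.nat_iff.1 hf)

theorem comp (hf : TotalRecIn O f) (hg : TotalRecIn O g) : TotalRecIn O fun n => f (g n) :=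
  (Nat.RecursiveIn.comp hf hg).of_eq fun n => by simp

theorem pair (hf : TotalRecIn O f) (hg : TotalRecIn O g) :
    TotalRecIn O fun n => Nat.pair (f n) (g n) :=
  (Nat.RecursiveIn.pair hf hg).of_eq fun n => by simp [Seq.seq]

theorem find (hf : TotalRecIn O f) (hex : ∀ a, ∃ n, f (Nat.pair a n) = 0) :
    ∃ g, TotalRecIn O g ∧ ∀ a, f (Nat.pair a (g a)) = 0 := by
  refine ⟨fun a => Nat.find (hex a), ?_, fun a => Nat.find_spec (hex a)⟩
  refine (Nat.RecursiveIn.rfind hf).of_eq fun a => ?_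
  refine Part.eq_some_iff.2 (Nat.mem_rfind.2 ⟨?_, fun {m} hm => ?_⟩)
  · simpa using Nat.find_spec (hex a)
  · simpa using Nat.find_min (hex a) hm

/-- Sequences defined by a computable recursion with one oracle value per step. -/
theorem iterate {L s q : ℕ → ℕ} (hh : TotalRecIn O h) (hs : Computable s) (hq : Computable q)
    (hL : ∀ n, L (n + 1) = s (Nat.pair (L n) (h (q (Nat.pair n (L n)))))) : TotalRecIn O L := by
  let step : ℕ → ℕ := fun z =>
    s (Nat.pair z.unpair.2.unpair.2
      (h (q (Nat.pair z.unpair.2.unpair.1 z.unpair.2.unpair.2))))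
  have hr : Primrec fun z : ℕ => z.unpair.2 := Primrec.snd.comp Primrec.unpair
  have hl : Primrec fun z : ℕ => z.unpair.1 := Primrec.fst.comp Primrec.unpair
  have h22 : TotalRecIn O fun z : ℕ => z.unpair.2.unpair.2 := of_computable (hr.comp hr).to_comp
  have h21 : TotalRecIn O fun z : ℕ => z.unpair.2.unpair.1 := of_computable (hl.comp hr).to_comp
  have hstep : TotalRecIn O step :=
    (of_computable hs).comp (h22.pair (hh.comp ((of_computable hq).comp (h21.pair h22))))
  have hrec := Nat.RecursiveIn.prec
    (of_computable (O := O) (Computable.const (L 0))) hstep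
  -- Primitive recursion carries a parameter, here the dummy 0.
  refine (Nat.RecursiveIn.comp hrec ((of_computable (O := O) (Computable.const 0)).pair
    (of_computable Computable.id))).of_eq fun n => ?_
  simp only [id, Part.bind_eq_bind, Part.bind_some, Nat.unpair_pair]
  induction n with
  | zero => rfl
  | succ n ih =>
    simp only at ih ⊢
    rw [ih]
    simp [step, hL]

end TotalRecIn

/-- The oracle given by the characteristic function of `X`. -/
abbrev setOracle (X : Set ℕ) : Set (ℕ →. ℕ) :=
  {fun n => Part.some (charFun X n)}

theorem totalRecIn_charFun (X : Set ℕ) : TotalRecIn (setOracle X) (charFun X) :=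
  Nat.RecursiveIn.oracle _ rfl

theorem computableFromSet_bool_iff {X : Set ℕ} {f : ℕ → Bool} :
    ComputableFromSet X f ↔ TotalRecIn (setOracle X) fun n => encode (f n) := by
  unfold ComputableFromSet ComputableIn RecursiveIn TotalRecIn
  simp

/-- Appending a symbol to a string, on codes. -/
def concatCode (z : ℕ) : ℕ :=
  encode ((decode (α := List Bool) z.unpair.1).getD [] ++
    [(decode (α := Bool) z.unpair.2).getD false])

theorem primrec_concatCode : Primrec concatCode := by
  refine Primrec.encode.comp (Primrec.list_concat.comp ?_ ?_)
  · exact Primrec.option_getD.comp (Primrec.decode.comp (Primrec.fst.comp Primrec.unpair))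
      (Primrec.const _)
  · exact Primrec.option_getD.comp (Primrec.decode.comp (Primrec.snd.comp Primrec.unpair))
      (Primrec.const _)

theorem concatCode_pair_encode (σ : List Bool) (v : Bool) :
    concatCode (Nat.pair (encode σ) (encode v)) = encode (σ ++ [v]) := by
  simp only [concatCode, Nat.unpair_pair, encodek, Option.getD_some]

theorem TotalRecIn.encode_initSeg (X : Set ℕ) :
    TotalRecIn (setOracle X) fun n => encode (initSeg (boolInd X) n) := by
  refine TotalRecIn.iterate (totalRecIn_charFun X) primrec_concatCode.to_comp
    (q := fun z => z.unpair.1) (Primrec.fst.comp Primrec.unpair).to_comp fun n => ?_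
  rw [Nat.unpair_pair, initSeg_succ, charFun_eq_encode, concatCode_pair_encode]

/-! ### Enumerability relative to `C`. -/

/-- Predicates that are recursively enumerable relative to the set `C`. -/
def REIn {α : Type*} [Primcodable α] (C : Set ℕ) (p : α → Prop) : Prop :=
  ∃ r : List Bool × α → Prop, REPred r ∧ ∀ a, p a ↔ ∃ n, r (initSeg (boolInd C) n, a)

namespace REIn

variable {α β : Type*} [Primcodable α] [Primcodable β] {C : Set ℕ}

theorem comp {p : β → Prop} (hp : REIn C p) {f : α → β} (hf : Computable f) :
    REIn C fun a => p (f a) := by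
  obtain ⟨r, hr, hpr⟩ := hp
  exact ⟨fun x => r (x.1, f x.2), hr.comp (Computable.fst.pair (hf.comp Computable.snd)),
    fun a => hpr (f a)⟩

theorem and_rePred {p q : α → Prop} (hp : REIn C p) (hq : REPred q) :
    REIn C fun a => p a ∧ q a := by
  obtain ⟨r, hr, hpr⟩ := hp
  exact ⟨fun x => r x ∧ q x.2, hr.and (hq.comp Computable.snd), fun a => by simp [hpr]⟩

theorem exists_snd {p : α → β → Prop} (hp : REIn C (fun x : α × β => p x.1 x.2)) :
    REIn C fun a => ∃ b, p a b := by
  obtain ⟨r, hr, hpr⟩ := hp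
  refine ⟨fun x => ∃ b, r (x.1, x.2, b), REPred.exists_snd (p := fun (x : List Bool × α) (b : β) => r (x.1, x.2, b))
    (hr.comp ((Computable.fst.comp Computable.fst).pair
      ((Computable.snd.comp Computable.fst).pair Computable.snd))), fun a => ?_⟩
  rw [exists_comm]
  exact exists_congr fun b => hpr (a, b)

/-- Single-valued selection from a relation recursively enumerable in `C`. -/
theorem exists_computable_selection {V : ℕ → Bool → Prop}
    (hV : REIn C fun x : ℕ × Bool => V x.1 x.2) (hex : ∀ n, ∃ v, V n v) :
    ∃ f : ℕ → Bool, ComputableFromSet C f ∧ ∀ n, V n (f n) := by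
  obtain ⟨r, hr, hVr⟩ := hV
  obtain ⟨M, hM, -, hrM⟩ := hr.exists_primrec_kernel
  obtain ⟨D, hD, hDe⟩ : ∃ D : ℕ → ℕ × Bool × ℕ, Primrec D ∧ ∀ t, D (encode t) = t :=
    ⟨fun n => (decode n).getD (0, false, 0),
      Primrec.option_getD.comp Primrec.decode (Primrec.const _), fun t => by beta_reduce; rw [encodek]; rfl⟩
  obtain ⟨E, hE, hEe⟩ : ∃ E : ℕ → List Bool, Primrec E ∧ ∀ t, E (encode t) = t :=
    ⟨fun n => (decode n).getD [],
      Primrec.option_getD.comp Primrec.decode (Primrec.const _), fun t => by beta_reduce; rw [encodek]; rfl⟩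
  -- The search runs over triples (length of the segment of `C`, value, stage); 0 signals success.
  let test : ℕ → ℕ := fun z =>
    bif M (E z.unpair.1, z.unpair.2.unpair.1, (D z.unpair.2.unpair.2).2.1)
      (D z.unpair.2.unpair.2).2.2 then 0 else 1
  have hl : Primrec fun z : ℕ => z.unpair.1 := Primrec.fst.comp Primrec.unpair
  have hrr : Primrec fun z : ℕ => z.unpair.2 := Primrec.snd.comp Primrec.unpair
  have hd : Primrec fun z : ℕ => D z.unpair.2.unpair.2 := hD.comp (hrr.comp hrr)
  have htest : Primrec test :=
    Primrec.cond (hM.comp (Primrec.pair (hE.comp hl) (Primrec.pair (hl.comp hrr)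
      (Primrec.fst.comp (Primrec.snd.comp hd)))) (Primrec.snd.comp (Primrec.snd.comp hd)))
      (Primrec.const 0) (Primrec.const 1)
  have hlen : Primrec fun w : ℕ => (D w.unpair.2).1 := Primrec.fst.comp (hD.comp hrr)
  have hF := (TotalRecIn.of_computable (O := setOracle C) htest.to_comp).comp
    (((TotalRecIn.encode_initSeg C).comp (TotalRecIn.of_computable hlen.to_comp)).pair
      (TotalRecIn.of_computable Computable.id))
  simp only [test, Nat.unpair_pair, id, hEe] at hF
  obtain ⟨g, hg, hgz⟩ := hF.find fun a => by
    obtain ⟨v, hv⟩ := hex a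
    obtain ⟨n, hn⟩ := (hVr (a, v)).1 hv
    obtain ⟨s, hs⟩ := (hrM _).1 hn
    refine ⟨encode (n, v, s), ?_⟩
    simp only [Nat.unpair_pair, hDe, hs, cond_true]
  simp only [Nat.unpair_pair] at hgz
  refine ⟨fun a => (D (g a)).2.1, computableFromSet_bool_iff.2 ?_, fun a => ?_⟩
  · exact (TotalRecIn.of_computable
      (Primrec.encode.comp (Primrec.fst.comp (Primrec.snd.comp hD))).to_comp).comp hg
  · refine (hVr (a, _)).2 ⟨(D (g a)).1, (hrM _).2 ⟨(D (g a)).2.2, ?_⟩⟩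
    have := hgz a
    by_contra hcon
    rw [Bool.not_eq_true] at hcon
    rw [hcon] at this
    exact absurd this (by simp)

end REIn

/-! ### The use principle. -/

/-- A monotone partial computable functional acting on finite oracle segments. -/
structure FiniteUseFunctional (Ψ : List ℕ → ℕ →. ℕ) : Prop where
  partrec : Partrec₂ Ψ
  mono : ∀ ⦃σ τ : List ℕ⦄, σ <+: τ → ∀ n i, i ∈ Ψ σ n → i ∈ Ψ τ n

theorem initSeg_prefix {β : Type*} (f : ℕ → β) {m n : ℕ} (h : m ≤ n) :
    initSeg f m <+: initSeg f n := by
  rw [← take_initSeg f h]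
  exact List.take_prefix _ _

/-- `Ψ` computes `f` from the oracle `g`. -/
def FunctionalComputes (Ψ : List ℕ → ℕ →. ℕ) (g : ℕ → ℕ) (f : ℕ →. ℕ) : Prop :=
  ∀ n i, i ∈ f n ↔ ∃ m, i ∈ Ψ (initSeg g m) n

section UsePrinciple

variable {g : ℕ → ℕ} {Ψ Φ : List ℕ → ℕ →. ℕ} {f h : ℕ →. ℕ}

theorem FiniteUseFunctional.of_partrec (hf : Nat.Partrec f) :
    FiniteUseFunctional fun _ => f :=
  ⟨(Partrec.nat_iff.2 hf).comp Computable.snd, fun _ _ _ _ _ h => h⟩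

theorem FiniteUseFunctional.pair (hΨ : FiniteUseFunctional Ψ) (hΦ : FiniteUseFunctional Φ) :
    FiniteUseFunctional fun τ n => (Ψ τ n).bind fun x => (Φ τ n).map fun y => Nat.pair x y := by
  refine ⟨?_, fun σ τ hst n i => ?_⟩
  · refine Partrec.bind hΨ.partrec (Partrec.map (Partrec.comp hΦ.partrec Computable.fst) ?_)
    exact (Primrec₂.natPair.comp (Primrec.snd.comp Primrec.fst) Primrec.snd).to_comp
  · simp only [Part.mem_bind_iff, Part.mem_map_iff]
    rintro ⟨x, hx, y, hy, rfl⟩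
    exact ⟨x, hΨ.mono hst n x hx, y, hΦ.mono hst n y hy, rfl⟩

theorem FiniteUseFunctional.comp (hΨ : FiniteUseFunctional Ψ) (hΦ : FiniteUseFunctional Φ) :
    FiniteUseFunctional fun τ n => (Φ τ n).bind (Ψ τ) := by
  refine ⟨?_, fun σ τ hst n i => ?_⟩
  · exact Partrec.bind hΦ.partrec
      (hΨ.partrec.comp (Computable.fst.comp Computable.fst) Computable.snd)
  · intro hi
    obtain ⟨x, hx, hi⟩ := Part.mem_bind_iff.1 hi
    exact Part.mem_bind_iff.2 ⟨x, hΦ.mono hst n x hx, hΨ.mono hst x i hi⟩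

/-- Primitive recursion of partial functions. -/
def precFun (f h : ℕ →. ℕ) (a n : ℕ) : Part ℕ :=
  n.rec (f a) fun y IH => IH.bind fun i => h (Nat.pair a (Nat.pair y i))

theorem mem_precFun_succ {a n i : ℕ} :
    i ∈ precFun f h a (n + 1) ↔
      ∃ j, j ∈ precFun f h a n ∧ i ∈ h (Nat.pair a (Nat.pair n j)) :=
  Part.mem_bind_iff

theorem precFun_mono {f' h' : ℕ →. ℕ} (hf : ∀ n i, i ∈ f n → i ∈ f' n)
    (hh : ∀ n i, i ∈ h n → i ∈ h' n) {a n i : ℕ} (hi : i ∈ precFun f h a n) :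
    i ∈ precFun f' h' a n := by
  induction n generalizing i with
  | zero => exact hf a i hi
  | succ n ih =>
    obtain ⟨j, hj, hij⟩ := mem_precFun_succ.1 hi
    exact mem_precFun_succ.2 ⟨j, ih hj, hh _ _ hij⟩

theorem FiniteUseFunctional.prec (hΨ : FiniteUseFunctional Ψ) (hΦ : FiniteUseFunctional Φ) :
    FiniteUseFunctional fun τ p => precFun (Ψ τ) (Φ τ) p.unpair.1 p.unpair.2 := by
  have hl : Primrec fun z : List ℕ × ℕ => z.2.unpair.1 :=
    Primrec.fst.comp (Primrec.unpair.comp Primrec.snd)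
  have hr : Primrec fun z : List ℕ × ℕ => z.2.unpair.2 :=
    Primrec.snd.comp (Primrec.unpair.comp Primrec.snd)
  refine ⟨?_, fun σ τ hst p i hi =>
    precFun_mono (fun n i => hΨ.mono hst n i) (fun n i => hΦ.mono hst n i) hi⟩
  refine Partrec.nat_rec (h := fun (z : List ℕ × ℕ) (y : ℕ × ℕ) =>
    Φ z.1 (Nat.pair z.2.unpair.1 (Nat.pair y.1 y.2))) hr.to_comp
    (hΨ.partrec.comp Computable.fst hl.to_comp) ?_
  refine hΦ.partrec.comp (Computable.fst.comp Computable.fst) (Primrec.to_comp ?_)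
  exact Primrec₂.natPair.comp (hl.comp Primrec.fst)
    (Primrec₂.natPair.comp (Primrec.fst.comp Primrec.snd) (Primrec.snd.comp Primrec.snd))

/-- Unbounded search for a zero. -/
def rfindZero (f : ℕ →. ℕ) (a : ℕ) : Part ℕ :=
  Nat.rfind fun n => (f (Nat.pair a n)).map fun m => decide (m = 0)

theorem mem_rfindZero {a n : ℕ} :
    n ∈ rfindZero f a ↔
      0 ∈ f (Nat.pair a n) ∧ ∀ m < n, ∃ y, y ≠ 0 ∧ y ∈ f (Nat.pair a m) := by
  refine Nat.mem_rfind.trans ?_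
  simp only [Part.mem_map_iff]
  constructor
  · rintro ⟨⟨y, hy, h0⟩, h2⟩
    have : y = 0 := by simpa using h0
    subst this
    refine ⟨hy, fun m hm => ?_⟩
    obtain ⟨z, hz, hz0⟩ := h2 hm
    exact ⟨z, by simpa using hz0, hz⟩
  · rintro ⟨h0, h2⟩
    refine ⟨⟨0, h0, by simp⟩, fun {m} hm => ?_⟩
    obtain ⟨z, hz0, hz⟩ := h2 m hm
    exact ⟨z, hz, by simpa using hz0⟩

theorem FiniteUseFunctional.rfind (hΨ : FiniteUseFunctional Ψ) :
    FiniteUseFunctional fun τ a => rfindZero (Ψ τ) a := by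
  refine ⟨?_, fun σ τ hst a n => ?_⟩
  · refine Partrec.rfind (p := fun (z : List ℕ × ℕ) n =>
      (Ψ z.1 (Nat.pair z.2 n)).map fun m => decide (m = 0)) ?_
    refine Partrec.map (hΨ.partrec.comp (Computable.fst.comp Computable.fst)
      (Primrec₂.natPair.comp (Primrec.snd.comp Primrec.fst) Primrec.snd).to_comp) ?_
    have : PrimrecPred fun z : ((List ℕ × ℕ) × ℕ) × ℕ => z.2 = 0 :=
      Primrec.eq.comp Primrec.snd (Primrec.const 0)
    exact this.decide.to_comp
  · simp only [mem_rfindZero]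
    rintro ⟨h0, h2⟩
    refine ⟨hΨ.mono hst _ _ h0, fun m hm => ?_⟩
    obtain ⟨y, hy, hy'⟩ := h2 m hm
    exact ⟨y, hy, hΨ.mono hst _ _ hy'⟩

/-- Every function recursive in a total oracle is computed by a functional with finite use. -/
theorem Nat.RecursiveIn.exists_functional
    (hf : Nat.RecursiveIn {fun n => Part.some (g n)} f) :
    ∃ Ψ, FiniteUseFunctional Ψ ∧ FunctionalComputes Ψ g f := by
  have base : ∀ f : ℕ →. ℕ, Nat.Partrec f →
      ∃ Ψ, FiniteUseFunctional Ψ ∧ FunctionalComputes Ψ g f := fun f hf =>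
    ⟨_, .of_partrec hf, fun n i => by simp⟩
  -- Convergences with different uses are merged by passing to the longer segment.
  have up : ∀ {Ψ : List ℕ → ℕ →. ℕ}, FiniteUseFunctional Ψ → ∀ {m k n i : ℕ}, m ≤ k →
      i ∈ Ψ (initSeg g m) n → i ∈ Ψ (initSeg g k) n := fun hΨ _ _ _ _ h =>
    hΨ.mono (initSeg_prefix g h) _ _
  induction hf with
  | zero => exact base _ .zero
  | succ => exact base _ .succ
  | left => exact base _ .left
  | right => exact base _ .right
  | oracle f hf =>
    obtain rfl : f = fun n => Part.some (g n) := hf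
    refine ⟨fun τ n => Part.ofOption τ[n]?, ⟨?_, ?_⟩, fun n i => ?_⟩
    · exact Computable.ofOption Computable.list_getElem?
    · intro σ τ hst n i
      simp only [Part.mem_ofOption, Option.mem_def]
      obtain ⟨ρ, rfl⟩ := hst
      intro h
      rw [List.getElem?_append_left (List.getElem?_eq_some_iff.1 h).1, h]
    · simp only [Part.mem_ofOption, Option.mem_def, getElem?_initSeg, Part.mem_some_iff]
      constructor
      · rintro rfl
        exact ⟨n + 1, by simp⟩
      · rintro ⟨m, hm⟩
        split_ifs at hm
        exact (Option.some_inj.1 hm).symm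
  | pair _ _ ihf ihh =>
    obtain ⟨Ψ, hΨ, hf⟩ := ihf
    obtain ⟨Φ, hΦ, hh⟩ := ihh
    refine ⟨_, hΨ.pair hΦ, fun n i => ?_⟩
    simp only [Seq.seq, Part.map_eq_map, Part.bind_map, Part.mem_bind_iff,
      Part.mem_map_iff]
    constructor
    · rintro ⟨x, hx, y, hy, rfl⟩
      obtain ⟨m, hm⟩ := (hf _ _).1 hx
      obtain ⟨k, hk⟩ := (hh _ _).1 hy
      exact ⟨max m k, x, up hΨ (le_max_left m k) hm, y, up hΦ (le_max_right m k) hk, rfl⟩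
    · rintro ⟨m, x, hx, y, hy, rfl⟩
      exact ⟨x, (hf _ _).2 ⟨m, hx⟩, y, (hh _ _).2 ⟨m, hy⟩, rfl⟩
  | comp _ _ ihf ihh =>
    obtain ⟨Ψ, hΨ, hf⟩ := ihf
    obtain ⟨Φ, hΦ, hh⟩ := ihh
    refine ⟨_, hΨ.comp hΦ, fun n i => ?_⟩
    refine Part.mem_bind_iff.trans (Iff.trans ?_ (exists_congr fun m => Part.mem_bind_iff.symm))
    constructor
    · rintro ⟨x, hx, hi⟩
      obtain ⟨m, hm⟩ := (hh _ _).1 hx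
      obtain ⟨k, hk⟩ := (hf _ _).1 hi
      exact ⟨max m k, x, up hΦ (le_max_left m k) hm, up hΨ (le_max_right m k) hk⟩
    · rintro ⟨m, x, hx, hi⟩
      exact ⟨x, (hh _ _).2 ⟨m, hx⟩, (hf _ _).2 ⟨m, hi⟩⟩
  | @prec f h _ _ ihf ihh =>
    obtain ⟨Ψ, hΨ, hf⟩ := ihf
    obtain ⟨Φ, hΦ, hh⟩ := ihh
    refine ⟨_, hΨ.prec hΦ, fun p i => ?_⟩
    change i ∈ precFun f h p.unpair.1 p.unpair.2 ↔ _
    generalize p.unpair.1 = a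
    generalize p.unpair.2 = n
    refine ⟨fun hi => ?_, fun ⟨m, hi⟩ => precFun_mono (fun n i h => (hf n i).2 ⟨m, h⟩)
      (fun n i h => (hh n i).2 ⟨m, h⟩) hi⟩
    induction n generalizing i with
    | zero => exact (hf a i).1 hi
    | succ n ih =>
      obtain ⟨j, hj, hij⟩ := mem_precFun_succ.1 hi
      obtain ⟨m, hm⟩ := ih j hj
      obtain ⟨k, hk⟩ := (hh _ _).1 hij
      exact ⟨max m k, mem_precFun_succ.2 ⟨j,
        precFun_mono (fun _ _ => up hΨ (le_max_left m k)) (fun _ _ => up hΦ (le_max_left m k)) hm,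
        up hΦ (le_max_right m k) hk⟩⟩
  | @rfind f _ ih =>
    obtain ⟨Ψ, hΨ, hf⟩ := ih
    refine ⟨_, hΨ.rfind, fun a n => ?_⟩
    change n ∈ rfindZero f a ↔ _
    simp only [mem_rfindZero]
    constructor
    · rintro ⟨h0, h2⟩
      obtain ⟨m, hm⟩ := (hf _ _).1 h0
      -- The finitely many tests before the zero need a common use.
      have : ∀ n' ≤ n, ∃ k, ∀ j < n', ∃ y, y ≠ 0 ∧ y ∈ Ψ (initSeg g k) (Nat.pair a j) := by
        intro n'
        induction n' with
        | zero => exact fun _ => ⟨0, by simp⟩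
        | succ n' ih =>
          intro hn'
          obtain ⟨k, hk⟩ := ih (by omega)
          obtain ⟨y, hy, hy'⟩ := h2 n' (by omega)
          obtain ⟨l, hl⟩ := (hf _ _).1 hy'
          refine ⟨max k l, fun j hj => ?_⟩
          rcases Nat.lt_succ_iff_lt_or_eq.1 hj with hj | rfl
          · obtain ⟨z, hz, hz'⟩ := hk j hj
            exact ⟨z, hz, up hΨ (le_max_left k l) hz'⟩
          · exact ⟨y, hy, up hΨ (le_max_right k l) hl⟩
      obtain ⟨k, hk⟩ := this n le_rfl
      refine ⟨max m k, up hΨ (le_max_left m k) hm, fun j hj => ?_⟩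
      obtain ⟨y, hy, hy'⟩ := hk j hj
      exact ⟨y, hy, up hΨ (le_max_right m k) hy'⟩
    · rintro ⟨m, h0, h2⟩
      refine ⟨(hf _ _).2 ⟨m, h0⟩, fun j hj => ?_⟩
      obtain ⟨y, hy, hy'⟩ := h2 j hj
      exact ⟨y, hy, (hf _ _).2 ⟨m, hy'⟩⟩

end UsePrinciple

/-! ### Oracle segments of a join. -/

/-- The initial segment of `setJoin G C` determined by initial segments of `G` and of `C`. -/
def joinSeg (τ γ : List Bool) : List ℕ :=
  (List.range (2 * τ.length)).map fun x =>
    if x % 2 = 0 then encode (τ.getD (x / 2) false) else encode (γ.getD (x / 2) false)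

theorem mem_setJoin_two_mul {G C : Set ℕ} {n : ℕ} : 2 * n ∈ setJoin G C ↔ n ∈ G := by
  simp only [setJoin, Set.mem_union, Set.mem_image]
  constructor
  · rintro (⟨m, hm, h⟩ | ⟨m, -, h⟩)
    · obtain rfl : m = n := by omega
      exact hm
    · omega
  · exact fun h => Or.inl ⟨n, h, rfl⟩

theorem mem_setJoin_two_mul_add_one {G C : Set ℕ} {n : ℕ} :
    2 * n + 1 ∈ setJoin G C ↔ n ∈ C := by
  simp only [setJoin, Set.mem_union, Set.mem_image]
  constructor
  · rintro (⟨m, -, h⟩ | ⟨m, hm, h⟩)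
    · omega
    · obtain rfl : m = n := by omega
      exact hm
  · exact fun h => Or.inr ⟨n, h, rfl⟩

theorem joinSeg_initSeg (G C : Set ℕ) (n : ℕ) :
    joinSeg (initSeg (boolInd G) n) (initSeg (boolInd C) n) =
      initSeg (charFun (setJoin G C)) (2 * n) := by
  unfold joinSeg
  rw [length_initSeg]
  refine List.map_congr_left fun x hx => ?_
  have hx : x < 2 * n := List.mem_range.1 hx
  have hlt : x / 2 < n := by omega
  rw [charFun_eq_encode]
  split_ifs with h
  · congr 1
    rw [List.getD_eq_getElem?_getD, getElem?_initSeg, if_pos hlt, Option.getD_some,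
      Bool.eq_iff_iff, boolInd_eq_true, boolInd_eq_true, ← mem_setJoin_two_mul (C := C),
      show 2 * (x / 2) = x by omega]
  · congr 1
    rw [List.getD_eq_getElem?_getD, getElem?_initSeg, if_pos hlt, Option.getD_some,
      Bool.eq_iff_iff, boolInd_eq_true, boolInd_eq_true, ← mem_setJoin_two_mul_add_one (G := G),
      show 2 * (x / 2) + 1 = x by omega]

theorem primrec_joinSeg : Primrec₂ joinSeg := by
  refine Primrec.list_map (Primrec.list_range.comp (Primrec.nat_mul.comp (Primrec.const 2)
    (Primrec.list_length.comp Primrec.fst))) ?_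
  have hdiv : Primrec fun z : (List Bool × List Bool) × ℕ => z.2 / 2 :=
    Primrec.nat_div.comp Primrec.snd (Primrec.const 2)
  refine Primrec.ite (Primrec.eq.comp (Primrec.nat_mod.comp Primrec.snd (Primrec.const 2))
    (Primrec.const 0)) (Primrec.encode.comp ?_) (Primrec.encode.comp ?_)
  · exact (Primrec.list_getD false).comp (Primrec.fst.comp Primrec.fst) hdiv
  · exact (Primrec.list_getD false).comp (Primrec.snd.comp Primrec.fst) hdiv

theorem rePred_mem_of_partrec {α σ : Type*} [Primcodable α] [Primcodable σ] {f : α →. σ}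
    (hf : Partrec f) : REPred fun x : α × σ => x.2 ∈ f x.1 := by
  classical
  have hp : Partrec fun x : α × σ => (f x.1).bind fun b =>
      ((if b = x.2 then some () else none : Option Unit) : Part Unit) := by
    refine Partrec.bind (hf.comp Computable.fst) (Computable.ofOption (Primrec.to_comp ?_))
    exact Primrec.ite (Primrec.eq.comp Primrec.snd (Primrec.snd.comp Primrec.fst))
      (Primrec.const _) (Primrec.const _)
  refine hp.dom_re.of_eq fun x => ?_
  rw [Part.dom_iff_mem]
  simp only [Part.mem_bind_iff]
  constructor
  · rintro ⟨_, b, hb, h⟩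
    split_ifs at h with hbx
    · exact hbx ▸ hb
    · simp at h
  · exact fun h => ⟨(), x.2, h, by simp⟩

/-- The graph of a function computable from `setJoin G C` is enumerated uniformly from initial
segments of `G` and `C`. -/
theorem ComputableFromSet.exists_rePred {G C : Set ℕ} {f : ℕ → Bool}
    (hf : ComputableFromSet (setJoin G C) f) :
    ∃ r : List Bool × List Bool × ℕ × Bool → Prop, REPred r ∧
      ∀ n v, f n = v ↔ ∃ m, r (initSeg (boolInd G) m, initSeg (boolInd C) m, n, v) := by
  obtain ⟨Ψ, hΨ, hfΨ⟩ := Nat.RecursiveIn.exists_functional (computableFromSet_bool_iff.1 hf)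
  refine ⟨fun x => encode x.2.2.2 ∈ Ψ (joinSeg x.1 x.2.1) x.2.2.1, ?_, fun n v => ?_⟩
  · have h1 : Computable fun x : List Bool × List Bool × ℕ × Bool =>
        (((joinSeg x.1 x.2.1, x.2.2.1) : List ℕ × ℕ), encode x.2.2.2) :=
      Primrec.to_comp (((primrec_joinSeg.comp Primrec.fst (Primrec.fst.comp Primrec.snd)).pair
        (Primrec.fst.comp (Primrec.snd.comp Primrec.snd))).pair
        (Primrec.encode.comp (Primrec.snd.comp (Primrec.snd.comp Primrec.snd))))
    exact (rePred_mem_of_partrec hΨ.partrec).comp h1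
  · simp only [joinSeg_initSeg]
    rw [← encode_inj, eq_comm, ← Part.mem_some_iff, hfΨ]
    constructor
    · rintro ⟨m, hm⟩
      exact ⟨m, hΨ.mono (initSeg_prefix _ (by omega)) _ _ hm⟩
    · rintro ⟨m, hm⟩
      exact ⟨2 * m, hm⟩

/-! ### Strings of given length, and PA-degree as avoidance. -/

/-- All strings of length `m` over the finite alphabet listed by `a`. -/
def stringsOfLength {κ : Type*} (a : List κ) : ℕ → List (List κ)
  | 0 => [[]]
  | m + 1 => (stringsOfLength a m).flatMap fun ρ => a.map fun x => x :: ρ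

theorem mem_stringsOfLength {κ : Type*} {a : List κ} (ha : ∀ x, x ∈ a) {m : ℕ} {ρ : List κ} :
    ρ ∈ stringsOfLength a m ↔ ρ.length = m := by
  induction m generalizing ρ with
  | zero => simp [stringsOfLength]
  | succ m ih =>
    cases ρ with
    | nil => simp [stringsOfLength]
    | cons x ρ => simp [stringsOfLength, ih, ha]

theorem primrec_stringsOfLength {κ : Type*} [Primcodable κ] (a : List κ) :
    Primrec (stringsOfLength a) := by
  have hstep : Primrec₂ fun (_ : ℕ) (L : List (List κ)) =>
      L.flatMap fun ρ => a.map fun x => x :: ρ := by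
    refine Primrec.list_flatMap Primrec.snd (Primrec.list_map (Primrec.const a) ?_)
    exact Primrec.list_cons.comp Primrec.snd (Primrec.snd.comp Primrec.fst)
  refine (Primrec.nat_rec₁ [[]] hstep).of_eq fun m => ?_
  induction m with
  | zero => rfl
  | succ m ih => simp only [stringsOfLength, ← ih]

/-- The graph of a partial computable function with Boolean values. -/
structure IsPartialComputableGraph (V : ℕ → Bool → Prop) : Prop where
  rePred : REPred fun x : ℕ × Bool => V x.1 x.2
  unique : ∀ n v w, V n v → V n w → v = w

/-- `f` differs from the partial function with graph `V` wherever the latter is defined. -/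
def Avoids (f : ℕ → Bool) (V : ℕ → Bool → Prop) : Prop :=
  ∀ n, ¬ V n (f n)

/-- No computability is claimed: this only serves to make the tree of avoiding strings infinite. -/
theorem IsPartialComputableGraph.exists_avoids {V : ℕ → Bool → Prop}
    (hV : IsPartialComputableGraph V) : ∃ f, Avoids f V := by
  classical
  refine ⟨fun n => !decide (V n true), fun n h => ?_⟩
  by_cases ht : V n true
  · simp only [ht, decide_true, Bool.not_true] at h
    exact Bool.noConfusion (hV.unique n _ _ ht h)
  · simp only [ht, decide_false, Bool.not_false] at h

/-- A set of PA-degree computes a function avoiding a given partial computable one. -/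
theorem IsOfPADegree.exists_avoids {X : Set ℕ} (hX : IsOfPADegree X) {V : ℕ → Bool → Prop}
    (hV : IsPartialComputableGraph V) : ∃ f, ComputableFromSet X f ∧ Avoids f V := by
  obtain ⟨M, hM, hmono, hVM⟩ := hV.rePred.exists_primrec_kernel
  -- The length of a string also bounds the stages searched, which makes the tree decidable;
  -- monotonicity of `M` makes it closed under initial segments.
  let T : Set (List Bool) :=
    {σ | ∀ n ∈ List.range σ.length, ¬ M (n, σ.getD n false) σ.length = true}
  have hmem : ∀ g n, initSeg g n ∈ T ↔ ∀ x < n, ¬ M (x, g x) n = true := by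
    intro g n
    simp only [T, Set.mem_ofPred_eq, length_initSeg, List.mem_range]
    refine forall₂_congr fun x hx => ?_
    rw [List.getD_eq_getElem?_getD, getElem?_initSeg, if_pos hx, Option.getD_some]
  have hT : IsBinaryTree T := by
    rintro σ τ ⟨ρ, rfl⟩ hτ n hn hcon
    have hn' : n < σ.length := List.mem_range.1 hn
    refine hτ n (List.mem_range.2 (by simp; omega)) ?_
    rw [List.getD_append _ _ _ _ hn']
    exact hmono _ _ _ (by simp) hcon
  have hinf : T.Infinite := by
    obtain ⟨g, hg⟩ := hV.exists_avoids
    refine Set.infinite_of_injective_forall_mem (f := initSeg g) ?_ ?_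
    · intro m n h
      simpa using congrArg List.length h
    · exact fun n => (hmem g n).2 fun x _ h => hg x ((hVM (x, g x)).2 ⟨n, h⟩)
  have hcomp : ComputablePred fun σ => σ ∈ T := by
    have hR : PrimrecRel fun (n : ℕ) (σ : List Bool) =>
        ¬ M (n, σ.getD n false) σ.length = true := by
      refine PrimrecPred.not ⟨inferInstance, ?_⟩
      simp only [Bool.decide_eq_true]
      exact hM.comp (Primrec.fst.pair ((Primrec.list_getD false).comp Primrec.snd Primrec.fst))
        (Primrec.list_length.comp Primrec.snd)
    exact (hR.forall_mem_list.comp (Primrec.list_range.comp Primrec.list_length)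
      Primrec.id).computablePred
  obtain ⟨f, hf, hfX⟩ := hX T hT hinf hcomp
  refine ⟨f, hfX, fun n hn => ?_⟩
  obtain ⟨s, hs⟩ := (hVM (n, f n)).1 hn
  exact (hmem f (max s (n + 1))).1 (hf _) n (by omega) (hmono _ _ _ (le_max_left _ _) hs)

/-- `σ` has an extension in `T` by exactly `m` further symbols. -/
def HasExtension (T : Set (List Bool)) (σ : List Bool) (m : ℕ) : Prop :=
  ∃ ρ : List Bool, ρ.length = m ∧ σ ++ ρ ∈ T

theorem HasExtension.mono {T : Set (List Bool)} (hT : IsBinaryTree T) {σ : List Bool} {m n : ℕ}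
    (hmn : m ≤ n) (h : HasExtension T σ n) : HasExtension T σ m := by
  obtain ⟨ρ, rfl, hρ⟩ := h
  exact ⟨ρ.take m, by simpa using hmn,
    hT _ _ ((List.prefix_append_right_inj σ).2 (List.take_prefix m ρ)) hρ⟩

/-- The graph of the partial function sending `σ` to a child above which `T` dies out strictly
before it does above the other child. -/
def dyingChild (T : Set (List Bool)) (n : ℕ) (v : Bool) : Prop :=
  ∃ σ : List Bool, encode σ = n ∧
    ∃ m, ¬ HasExtension T (σ ++ [v]) m ∧ HasExtension T (σ ++ [!v]) m

theorem rePred_hasExtension {T : Set (List Bool)} (hT : ComputablePred fun σ => σ ∈ T) :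
    REPred fun x : List Bool × ℕ => HasExtension T x.1 x.2 := by
  refine REPred.exists_snd (p := fun (x : List Bool × ℕ) ρ => ρ.length = x.2 ∧ x.1 ++ ρ ∈ T)
    (REPred.and ?_ (hT.to_re.comp (Primrec.list_append.comp (Primrec.fst.comp Primrec.fst)
      Primrec.snd).to_comp))
  have : PrimrecPred fun x : (List Bool × ℕ) × List Bool => x.2.length = x.1.2 :=
    Primrec.eq.comp (Primrec.list_length.comp Primrec.snd) (Primrec.snd.comp Primrec.fst)
  exact this.computablePred.to_re

/-- Only finitely many strings have the given length, so the universal quantifier is bounded. -/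
theorem rePred_not_hasExtension {T : Set (List Bool)} (hT : ComputablePred fun σ => σ ∈ T) :
    REPred fun x : List Bool × ℕ => ¬ HasExtension T x.1 x.2 := by
  have h : REPred fun x : (List Bool × ℕ) × List Bool => ¬ (x.1.1 ++ x.2 ∈ T) :=
    hT.not.to_re.comp (Primrec.list_append.comp (Primrec.fst.comp Primrec.fst)
      Primrec.snd).to_comp
  refine (REPred.forall_mem_list (p := fun (x : List Bool × ℕ) ρ => ¬ (x.1 ++ ρ ∈ T)) h
    (l := fun x => stringsOfLength [true, false] x.2)
    ((primrec_stringsOfLength _).comp Primrec.snd).to_comp).of_eq fun x => ?_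
  simp [HasExtension, mem_stringsOfLength]

/-- Two siblings cannot each die strictly before the other, since extendibility is monotone in the
depth. -/
theorem isPartialComputableGraph_dyingChild {T : Set (List Bool)} (hT : IsBinaryTree T)
    (hTc : ComputablePred fun σ => σ ∈ T) : IsPartialComputableGraph (dyingChild T) := by
  refine ⟨?_, ?_⟩
  · have hσ : Primrec fun y : ((ℕ × Bool) × List Bool) × ℕ => y.1.2 :=
      Primrec.snd.comp Primrec.fst
    have hv : Primrec fun y : ((ℕ × Bool) × List Bool) × ℕ => y.1.1.2 :=
      Primrec.snd.comp (Primrec.fst.comp Primrec.fst)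
    have h1 : Computable fun y : ((ℕ × Bool) × List Bool) × ℕ => (y.1.2 ++ [y.1.1.2], y.2) :=
      ((Primrec.list_concat.comp hσ hv).pair Primrec.snd).to_comp
    have h2 : Computable fun y : ((ℕ × Bool) × List Bool) × ℕ => (y.1.2 ++ [!y.1.1.2], y.2) :=
      ((Primrec.list_concat.comp hσ (Primrec.not.comp hv)).pair Primrec.snd).to_comp
    have h3 : PrimrecPred fun x : (ℕ × Bool) × List Bool => encode x.2 = x.1.1 :=
      Primrec.eq.comp (Primrec.encode.comp Primrec.snd) (Primrec.fst.comp Primrec.fst)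
    have h4 := ((rePred_not_hasExtension hTc).comp h1).and ((rePred_hasExtension hTc).comp h2)
    exact REPred.exists_snd (p := fun (x : ℕ × Bool) (σ : List Bool) => encode σ = x.1 ∧
      ∃ m, ¬ HasExtension T (σ ++ [x.2]) m ∧ HasExtension T (σ ++ [!x.2]) m)
      (h3.computablePred.to_re.and (REPred.exists_snd (p := fun (y : (ℕ × Bool) × List Bool) m =>
          ¬ HasExtension T (y.2 ++ [y.1.2]) m ∧ HasExtension T (y.2 ++ [!y.1.2]) m) h4))
  · rintro n v w ⟨σ, rfl, m, hm, hm'⟩ ⟨σ', hσ, k, hk, hk'⟩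
    obtain rfl := encode_injective hσ
    by_contra hne
    obtain rfl : w = !v := by cases v <;> cases w <;> simp_all
    rw [Bool.not_not] at hk'
    rcases le_total m k with h | h
    · exact hm (hk'.mono hT h)
    · exact hk (hm'.mono hT h)

/-- A set that is not of PA-degree fails to avoid some partial computable Boolean function. -/
theorem exists_graph_of_not_isOfPADegree {C : Set ℕ} (hC : ¬ IsOfPADegree C) :
    ∃ V, IsPartialComputableGraph V ∧ ∀ f, ComputableFromSet C f → ¬ Avoids f V := by
  unfold IsOfPADegree at hC
  push Not at hC
  obtain ⟨T, hT, hinf, hTc, hpath⟩ := hC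
  refine ⟨dyingChild T, isPartialComputableGraph_dyingChild hT hTc, fun f hfC hf => ?_⟩
  -- Following an avoiding `f` never enters a dying subtree: its sibling would survive longer, and
  -- `f` would agree with `dyingChild T`.
  let L : ℕ → List Bool := fun n => n.rec [] fun _ σ => σ ++ [f (encode σ)]
  let h : ℕ → Bool := fun n => f (encode (L n))
  have hLh : ∀ n, L n = (List.range n).map h := by
    intro n
    induction n with
    | zero => rfl
    | succ n ih =>
      rw [List.range_succ, List.map_append, ← ih]
      rfl
  have hext : ∀ n m, HasExtension T (L n) m := by
    intro n
    induction n with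
    | zero =>
      intro m
      by_contra hcon
      refine hinf ((List.finite_length_lt Bool m).subset fun σ hσ => ?_)
      by_contra hlen
      refine hcon (HasExtension.mono hT (n := σ.length) (by simpa using hlen) ⟨σ, rfl, hσ⟩)
    | succ n ih =>
      have hsplit : ∀ m, HasExtension T (L n ++ [true]) m ∨ HasExtension T (L n ++ [false]) m := by
        intro m
        obtain ⟨ρ, hρ, hT'⟩ := ih (m + 1)
        match ρ, hρ with
        | v :: ρ, hρ =>
          have : HasExtension T (L n ++ [v]) m := ⟨ρ, by simpa using hρ, by simpa using hT'⟩
          cases v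
          · exact Or.inr this
          · exact Or.inl this
      by_contra hcon
      push Not at hcon
      obtain ⟨m, hm⟩ := hcon
      refine hf (encode (L n)) ⟨L n, rfl, m, hm, ?_⟩
      change ¬ HasExtension T (L n ++ [f (encode (L n))]) m at hm
      rcases hsplit m with h' | h' <;> cases hv : f (encode (L n)) <;> simp_all
  refine hpath h (fun n => ?_) (computableFromSet_bool_iff.2 ?_)
  · obtain ⟨ρ, hρ, hmem⟩ := hext n 0
    rw [← hLh]
    simpa [List.length_eq_zero_iff.1 hρ] using hmem
  · have hfr := computableFromSet_bool_iff.1 hfC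
    refine hfr.comp (TotalRecIn.iterate hfr primrec_concatCode.to_comp
      (q := fun z => z.unpair.2) (Primrec.snd.comp Primrec.unpair).to_comp fun n => ?_)
    rw [Nat.unpair_pair, concatCode_pair_encode]

/-! ### The dichotomy for valuations. -/

/-- Among finite valuations, either an enumerated one agrees with `V`, or there are arguments
`x` all of whose valuations are not enumerated. -/
theorem exists_correct_or_forall_not_mem {C : Set ℕ} {V : ℕ → Bool → Prop}
    (hV : REPred fun x : ℕ × Bool => V x.1 x.2)
    (hC : ∀ f, ComputableFromSet C f → ¬ Avoids f V) (K : ℕ) {W : List (ℕ × Bool) → Prop}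
    (hW : REIn C W) :
    (∃ p, W p ∧ ∀ a ∈ p, V a.1 a.2) ∨
      ∃ x : List ℕ, x.length = K ∧ ∀ p : List (ℕ × Bool), p.map Prod.fst = x → ¬ W p := by
  induction K generalizing W with
  | zero =>
    by_cases h : W []
    · exact Or.inl ⟨[], h, by simp⟩
    · exact Or.inr ⟨[], rfl, fun p hp => by rwa [List.map_eq_nil_iff.1 hp]⟩
  | succ K ih =>
    have hcons : REIn C fun z : List (ℕ × Bool) × ℕ × Bool => W (z.2 :: z.1) :=
      hW.comp (Primrec.list_cons.comp Primrec.snd Primrec.fst).to_comp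
    -- One correct pair is guessed; as `V` is enumerable, the new predicate remains enumerable in
    -- `C`.
    have hW' : REIn C fun p => ∃ a : ℕ × Bool, W (a :: p) ∧ V a.1 a.2 :=
      REIn.exists_snd (p := fun (p : List (ℕ × Bool)) (a : ℕ × Bool) => W (a :: p) ∧ V a.1 a.2)
        (hcons.and_rePred (hV.comp Computable.snd))
    rcases ih hW' with ⟨p, ⟨a, ha, hVa⟩, hp⟩ | ⟨x, hx, hxW⟩
    · refine Or.inl ⟨a :: p, ha, fun a' ha' => ?_⟩
      rcases List.mem_cons.1 ha' with rfl | ha'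
      · exact hVa
      · exact hp a' ha'
    · right
      by_contra hcon
      push Not at hcon
      have hkey : REPred fun z : (ℕ × Bool) × List (ℕ × Bool) => z.2.map Prod.fst = x := by
        have : PrimrecPred fun z : (ℕ × Bool) × List (ℕ × Bool) => z.2.map Prod.fst = x :=
          Primrec.eq.comp (Primrec.list_map Primrec.snd (Primrec.fst.comp Primrec.snd))
            (Primrec.const x)
        exact this.computablePred.to_re
      have hWc : REIn C fun z : (ℕ × Bool) × List (ℕ × Bool) => W (z.1 :: z.2) :=
        hW.comp Primrec.list_cons.to_comp
      have hsel := REIn.exists_snd (p := fun (y : ℕ × Bool) (p : List (ℕ × Bool)) =>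
          W (y :: p) ∧ p.map Prod.fst = x) (hWc.and_rePred hkey)
      -- If `n :: x` had a valuation in `W` for every `n`, its value at `n` could be selected
      -- computably in `C`. Such an `f` agrees with `V` somewhere, which puts a valuation of `x`
      -- into the predicate just excluded.
      obtain ⟨f, hfC, hf⟩ := REIn.exists_computable_selection
        (V := fun n v => ∃ p : List (ℕ × Bool), W ((n, v) :: p) ∧ p.map Prod.fst = x) hsel
        fun n => by
          obtain ⟨p, hp, hpW⟩ := hcon (n :: x) (by simp [hx])
          cases p with
          | nil => simp at hp
          | cons a p =>
            obtain ⟨m, v⟩ := a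
            simp only [List.map_cons, List.cons.injEq] at hp
            exact ⟨v, p, hp.1 ▸ hpW, hp.2⟩
      refine hC f hfC fun n hn => ?_
      obtain ⟨p, hpW, hp⟩ := hf n
      exact hxW p hp ⟨(n, f n), hpW, hn⟩

/-! ### Compactness for colourings. -/

theorem take_initSeg_min {β : Type*} (f : ℕ → β) (m n : ℕ) :
    (initSeg f n).take m = initSeg f (min m n) := by
  rcases le_total m n with h | h
  · rw [take_initSeg f h, min_eq_left h]
  · rw [List.take_of_length_le (by simpa using h), min_eq_right h]

theorem eq_initSeg_getD {β : Type*} (d : β) (l : List β) :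
    l = initSeg (fun x => l.getD x d) l.length := by
  refine List.ext_getElem? fun x => ?_
  rw [getElem?_initSeg]
  split_ifs with h <;> simp [h]

/-- Compactness of the space of colourings: a sequence of conditions on initial segments covering
all colourings covers them at a finite stage. -/
theorem exists_stage_of_forall_exists {κ : Type*} [Finite κ] {ρ : ℕ → List κ → Prop}
    (h : ∀ Y : ℕ → κ, ∃ m, ρ m (initSeg Y m)) :
    ∃ N, ∀ Y : ℕ → κ, ∃ m ≤ N, ρ m (initSeg Y m) := by
  let _ : TopologicalSpace κ := ⊥
  have : DiscreteTopology κ := ⟨rfl⟩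
  have hopen : ∀ m, IsOpen {Y : ℕ → κ | ρ m (initSeg Y m)} := by
    intro m
    have hcont : Continuous fun (Y : ℕ → κ) (i : Fin m) => Y i :=
      continuous_pi fun i => continuous_apply _
    have : {Y : ℕ → κ | ρ m (initSeg Y m)} =
        (fun (Y : ℕ → κ) (i : Fin m) => Y i) ⁻¹' {z | ρ m (List.ofFn z)} := by
      ext Y
      simp only [Set.mem_ofPred_eq, Set.mem_preimage]
      rw [show List.ofFn (fun i : Fin m => Y i) = initSeg Y m by
        rw [initSeg, ← List.map_coe_finRange_eq_range, List.map_map, List.ofFn_eq_map]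
        rfl]
    rw [this]
    exact (isOpen_discrete _).preimage hcont
  obtain ⟨t, ht⟩ := isCompact_univ.elim_finite_subcover _ hopen
    (fun Y _ => Set.mem_iUnion.2 (h Y))
  refine ⟨t.sup id, fun Y => ?_⟩
  obtain ⟨m, hm, hY⟩ := Set.mem_iUnion₂.1 (ht (Set.mem_univ Y))
  exact ⟨m, Finset.le_sup (f := id) hm, hY⟩

/-- Universal quantification over colourings preserves enumerability in `C`. -/
theorem REIn.forall_colouring {κ α : Type*} [Finite κ] [Primcodable κ] [Primcodable α] {C : Set ℕ}
    {ρ : List Bool × List κ × α → Prop} (hρ : REPred ρ) :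
    REIn C fun a => ∀ Y : ℕ → κ, ∃ m, ρ (initSeg (boolInd C) m, initSeg Y m, a) := by
  obtain ⟨l, -, hl⟩ := Finite.exists_univ_list κ
  let q : List Bool × α → List κ → Prop := fun z y => ∃ m, ρ (z.1.take m, y.take m, z.2)
  have hq : REPred fun w : (List Bool × α) × List κ => q w.1 w.2 := by
    refine REPred.exists_snd (p := fun (w : (List Bool × α) × List κ) (m : ℕ) =>
      ρ (w.1.1.take m, w.2.take m, w.1.2)) (hρ.comp (f := fun w : ((List Bool × α) × List κ) × ℕ =>
        (w.1.1.1.take w.2, w.1.2.take w.2, w.1.1.2)) (Primrec.to_comp ?_))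
    exact (Primrec.list_take.comp Primrec.snd
      (Primrec.fst.comp (Primrec.fst.comp Primrec.fst))).pair
      ((Primrec.list_take.comp Primrec.snd (Primrec.snd.comp Primrec.fst)).pair
        (Primrec.snd.comp (Primrec.fst.comp Primrec.fst)))
  refine ⟨fun z => ∀ y ∈ stringsOfLength l z.1.length, q z y, REPred.forall_mem_list hq
    ((primrec_stringsOfLength l).comp (Primrec.list_length.comp Primrec.fst)).to_comp,
    fun a => ?_⟩
  simp only [mem_stringsOfLength hl, length_initSeg, q, take_initSeg_min]
  constructor
  · intro h
    obtain ⟨N, hN⟩ := exists_stage_of_forall_exists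
      (ρ := fun m y => ρ (initSeg (boolInd C) m, y, a)) h
    -- Length `N + 1` rather than `N` makes `y` nonempty, so its head can serve as default for an
    -- infinite colouring.
    refine ⟨N + 1, fun y hy => ?_⟩
    match y, hy with
    | x :: y, hy =>
      have hy' := eq_initSeg_getD x (x :: y)
      rw [hy] at hy'
      obtain ⟨m, hm, hρm⟩ := hN fun i => (x :: y).getD i x
      refine ⟨m, ?_⟩
      rwa [hy', take_initSeg_min, min_eq_left (by omega)]
  · rintro ⟨N, hN⟩ Y
    obtain ⟨m, hm⟩ := hN (initSeg Y N) (by simp)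
    exact ⟨min m N, by rwa [take_initSeg_min] at hm⟩

/-! ### Forcing conditions and their extensions. -/

/-- `τ` describes the union of `D` and a set of numbers beyond `u` coloured `a` by `y`, up to the
length of `τ`. -/
def Admissible {κ : Type*} (D : Finset ℕ) (u : ℕ) (a : κ) (τ : List Bool) (y : List κ) : Prop :=
  ∀ x ∈ List.range τ.length,
    (τ.getD x false = true → x ∈ D ∨ (u < x ∧ y[x]? = some a)) ∧
      (x ∈ D → τ.getD x false = true)

theorem primrecPred_admissible {κ : Type*} [Primcodable κ] (D : Finset ℕ) (u : ℕ) (a : κ) :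
    PrimrecPred fun z : List Bool × List κ => Admissible D u a z.1 z.2 := by
  classical
  have hx : Primrec fun w : ℕ × List Bool × List κ => w.1 := Primrec.fst
  have hD : PrimrecPred fun w : ℕ × List Bool × List κ => w.1 ∈ D := by
    have : PrimrecPred fun w : ℕ × List Bool × List κ => ∃ b ∈ D.toList, b = w.1 :=
      (PrimrecRel.exists_mem_list (R := fun b x : ℕ => b = x) Primrec.eq).comp
        (Primrec.const D.toList) hx
    exact this.of_eq fun w => by simp
  have hτ : PrimrecPred fun w : ℕ × List Bool × List κ => w.2.1.getD w.1 false = true :=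
    Primrec.eq.comp ((Primrec.list_getD false).comp (Primrec.fst.comp Primrec.snd) hx)
      (Primrec.const true)
  have hy : PrimrecPred fun w : ℕ × List Bool × List κ => w.2.2[w.1]? = some a :=
    Primrec.eq.comp (Primrec.list_getElem?.comp (Primrec.snd.comp Primrec.snd) hx)
      (Primrec.const (some a))
  have hu : PrimrecPred fun w : ℕ × List Bool × List κ => u < w.1 :=
    Primrec.nat_lt.comp (Primrec.const u) hx
  have hR : PrimrecRel fun (x : ℕ) (z : List Bool × List κ) =>
      (z.1.getD x false = true → x ∈ D ∨ (u < x ∧ z.2[x]? = some a)) ∧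
        (x ∈ D → z.1.getD x false = true) :=
    ((hτ.not.or (hD.or (hu.and hy))).and (hD.not.or hτ)).of_eq fun w => by
      simp only [imp_iff_not_or]
  exact hR.forall_mem_list.comp (Primrec.list_range.comp (Primrec.list_length.comp Primrec.fst))
    Primrec.id

theorem admissible_initSeg {κ : Type*} {D : Finset ℕ} {u : ℕ} {a : κ} {G : Set ℕ} {Y : ℕ → κ}
    (hDG : ↑D ⊆ G) (hG : ∀ x ∈ G, x ∈ D ∨ (u < x ∧ Y x = a)) (m : ℕ) :
    Admissible D u a (initSeg (boolInd G) m) (initSeg Y m) := by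
  intro x hx
  rw [List.mem_range, length_initSeg] at hx
  rw [List.getD_eq_getElem?_getD, getElem?_initSeg, getElem?_initSeg, if_pos hx, if_pos hx]
  simp only [Option.getD_some, boolInd_eq_true, Option.some_inj]
  exact ⟨hG x, fun h => hDG h⟩

/-- A requirement: an enumerable relation between initial segments of `G` and `C`, arguments and
values. -/
abbrev Requirement := List Bool × List Bool × ℕ × Bool → Prop

/-- Forcing conditions: an effectively closed nonempty class of colourings by finitely many
colours, with two stems for every colour, one inside `A` and one inside its complement. -/
structure Condition (A C : Set ℕ) where
  parts : ℕ
  rej : List Bool × List (Fin parts) → Prop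
  rePred_rej : REPred rej
  stem : Fin parts → Bool → Finset ℕ
  bound : ℕ
  mem_stem : ∀ i s, ∀ x ∈ stem i s, x ∈ A ↔ s = true
  exists_mem : ∃ X : ℕ → Fin parts, ∀ m, ¬ rej (initSeg (boolInd C) m, initSeg X m)

namespace Condition

variable {A C : Set ℕ}

/-- The class of colourings of a condition. -/
def Mem (c : Condition A C) (X : ℕ → Fin c.parts) : Prop :=
  ∀ m, ¬ c.rej (initSeg (boolInd C) m, initSeg X m)

/-- `G` extends the stem `c.stem i s` by elements of colour `i` beyond the bound. -/
def Gen (c : Condition A C) (i : Fin c.parts) (s : Bool) (G : Set ℕ) : Prop :=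
  ∃ X, c.Mem X ∧ ↑(c.stem i s) ⊆ G ∧ ∀ x ∈ G, x ∈ c.stem i s ∨ (c.bound < x ∧ X x = i)

/-- The functional `R` is forced to agree somewhere with `V`. -/
def ForcesAgreement (c : Condition A C) (V : ℕ → Bool → Prop) (i : Fin c.parts) (s : Bool)
    (R : Requirement) : Prop :=
  ∃ n v m, V n v ∧ ∀ G, c.Gen i s G → R (initSeg (boolInd G) m, initSeg (boolInd C) m, n, v)

/-- The functional `R` is forced to be undefined somewhere. -/
def ForcesDivergence (c : Condition A C) (i : Fin c.parts) (s : Bool) (R : Requirement) : Prop :=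
  ∃ n, ∀ G, c.Gen i s G → ∀ v m, ¬ R (initSeg (boolInd G) m, initSeg (boolInd C) m, n, v)

/-- On one of its two sides, the part `i` satisfies the corresponding requirement. -/
def Forces (c : Condition A C) (V : ℕ → Bool → Prop) (i : Fin c.parts) (R : Bool → Requirement) :
    Prop :=
  ∃ s, c.ForcesAgreement V i s (R s) ∨ c.ForcesDivergence i s (R s)

/-- Each part `i` of `d` refines the part `π i` of `c`. -/
structure Extends (d c : Condition A C) (π : Fin d.parts → Fin c.parts) : Prop where
  stem_subset : ∀ i s, c.stem (π i) s ⊆ d.stem i s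
  gen : ∀ i s G, d.Gen i s G → c.Gen (π i) s G

theorem Extends.trans {e d c : Condition A C} {π : Fin d.parts → Fin c.parts}
    {π' : Fin e.parts → Fin d.parts} (h' : e.Extends d π') (h : d.Extends c π) :
    e.Extends c (π ∘ π') :=
  ⟨fun i s => (h.stem_subset _ s).trans (h'.stem_subset i s),
    fun i s G hG => h.gen _ s G (h'.gen i s G hG)⟩

variable {V : ℕ → Bool → Prop}

/-- Both kinds of forcing quantify universally over `Gen`, which shrinks under extension. -/
theorem Extends.forces {d c : Condition A C} {π : Fin d.parts → Fin c.parts} (h : d.Extends c π)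
    {i : Fin d.parts} {R : Bool → Requirement} (hc : c.Forces V (π i) R) : d.Forces V i R := by
  obtain ⟨s, ⟨n, v, m, hV, hG⟩ | ⟨n, hG⟩⟩ := hc
  · exact ⟨s, Or.inl ⟨n, v, m, hV, fun G hd => hG G (h.gen i s G hd)⟩⟩
  · exact ⟨s, Or.inr ⟨n, fun G hd => hG G (h.gen i s G hd)⟩⟩

/-- A colouring of a segment, together with a splitting of each colour in two, is rejected, or
allows one of the parts in `U` to be extended to meet one of the values in `p`. -/
def Found (c : Condition A C) (U : Finset (Fin c.parts)) (R : Bool → Requirement)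
    (z : List Bool × List (Fin c.parts × Bool) × List (ℕ × Bool)) : Prop :=
  c.rej (z.1, z.2.1.map Prod.fst) ∨ ∃ a : Fin c.parts × Bool, a.1 ∈ U ∧
    ∃ τ : List Bool, (τ.length = z.2.1.length ∧ Admissible (c.stem a.1 a.2) c.bound a τ z.2.1) ∧
      ∃ b : ℕ × Bool, b ∈ z.2.2 ∧ R a.2 (τ, z.1, b)

theorem rePred_found (c : Condition A C) (U : Finset (Fin c.parts)) {R : Bool → Requirement}
    (hR : ∀ s, REPred (R s)) : REPred (c.Found U R) := by
  classical
  let Z := List Bool × List (Fin c.parts × Bool) × List (ℕ × Bool)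
  refine REPred.or ?_ (REPred.exists_finite fun a => ?_)
  · exact c.rePred_rej.comp (f := fun z : Z => (z.1, z.2.1.map Prod.fst))
      (Primrec.fst.pair (Primrec.list_map (Primrec.fst.comp Primrec.snd)
        (Primrec.fst.comp Primrec.snd).to₂)).to_comp
  · by_cases ha : a.1 ∈ U
    · simp only [ha, true_and]
      have hτ : Primrec fun w : Z × List Bool => w.2 := Primrec.snd
      have hy : Primrec fun w : Z × List Bool => w.1.2.1 :=
        Primrec.fst.comp (Primrec.snd.comp Primrec.fst)
      have h1 : PrimrecPred fun w : Z × List Bool => w.2.length = w.1.2.1.length :=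
        Primrec.eq.comp (Primrec.list_length.comp hτ) (Primrec.list_length.comp hy)
      have h2 : PrimrecPred fun w : Z × List Bool =>
          Admissible (c.stem a.1 a.2) c.bound a w.2 w.1.2.1 :=
        (primrecPred_admissible _ _ _).comp (hτ.pair hy)
      have h3 : PrimrecPred fun w : (Z × List Bool) × ℕ × Bool => w.2 ∈ w.1.1.2.2 := by
        have : PrimrecPred fun w : (Z × List Bool) × ℕ × Bool => ∃ b ∈ w.1.1.2.2, b = w.2 :=
          (PrimrecRel.exists_mem_list (R := fun b x : ℕ × Bool => b = x) Primrec.eq).comp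
            (Primrec.snd.comp (Primrec.snd.comp (Primrec.fst.comp Primrec.fst))) Primrec.snd
        exact this.of_eq fun w => by simp
      have h4 : REPred fun w : (Z × List Bool) × ℕ × Bool => R a.2 (w.1.2, w.1.1.1, w.2) :=
        (hR a.2).comp (Primrec.pair (Primrec.snd.comp Primrec.fst)
          (Primrec.pair (Primrec.fst.comp (Primrec.fst.comp Primrec.fst)) Primrec.snd)).to_comp
      have h5 : REPred fun w : Z × List Bool =>
          ∃ b : ℕ × Bool, b ∈ w.1.2.2 ∧ R a.2 (w.2, w.1.1, b) :=
        REPred.exists_snd (p := fun (w : Z × List Bool) (b : ℕ × Bool) =>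
          b ∈ w.1.2.2 ∧ R a.2 (w.2, w.1.1, b)) (h3.computablePred.to_re.and h4)
      exact REPred.exists_snd (p := fun (z : Z) (τ : List Bool) =>
        (τ.length = z.2.1.length ∧ Admissible (c.stem a.1 a.2) c.bound a τ z.2.1) ∧
          ∃ b : ℕ × Bool, b ∈ z.2.2 ∧ R a.2 (τ, z.1, b))
        ((h1.and h2).computablePred.to_re.and h5)
    · exact REPred.const_false.of_eq fun z => by simp [ha]

/-- Extending one stem by finitely many elements of its part, so as to force agreement. -/
theorem exists_extends_of_found (c : Condition A C) {U : Finset (Fin c.parts)}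
    {R : Bool → Requirement} {p : List (ℕ × Bool)} (hp : ∀ b ∈ p, V b.1 b.2)
    (hW : ∀ Y : ℕ → Fin c.parts × Bool, ∃ m,
      c.Found U R (initSeg (boolInd C) m, initSeg Y m, p))
    (hU : ∀ i ∉ U, c.Forces V i R) :
    ∃ (d : Condition A C) (π : Fin d.parts → Fin c.parts), d.Extends c π ∧
      ∃ U' : Finset (Fin d.parts), U'.card < U.card ∧ ∀ i ∉ U', d.Forces V i R := by
  classical
  obtain ⟨X, hX⟩ := c.exists_mem
  -- Since `hW` covers all splittings, it applies to the one given by `A`, however complicated `A`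
  -- is.
  obtain ⟨m, hm⟩ := hW fun x => (X x, boolInd A x)
  rcases hm with hm | ⟨⟨i, s⟩, hi, τ, ⟨hlen, hadm⟩, b, hb, hRb⟩
  · rw [map_initSeg] at hm
    exact absurd hm (hX m)
  rw [length_initSeg] at hlen
  have hadm' : ∀ x < m, (τ.getD x false = true →
      x ∈ c.stem i s ∨ (c.bound < x ∧ X x = i ∧ boolInd A x = s)) ∧
      (x ∈ c.stem i s → τ.getD x false = true) := by
    intro x hx
    have := hadm x (List.mem_range.2 (by omega))
    rw [getElem?_initSeg, if_pos hx] at this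
    simpa only [Option.some_inj, Prod.mk.injEq] using this
  let F : Finset ℕ := (Finset.range m).filter fun x => τ.getD x false = true
  let d : Condition A C :=
    { parts := c.parts
      -- Freezing the colouring below `m` keeps the new stem elements coloured `i`, so that `Gen`
      -- for `d` implies `Gen` for `c`.
      rej := fun z => c.rej z ∨ ¬ z.2.take m = (initSeg X m).take z.2.length
      rePred_rej := by
        refine c.rePred_rej.or ?_
        have : PrimrecPred fun z : List Bool × List (Fin c.parts) =>
            z.2.take m = (initSeg X m).take z.2.length :=
          Primrec.eq.comp (Primrec.list_take.comp (Primrec.const m) Primrec.snd)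
            (Primrec.list_take.comp (Primrec.list_length.comp Primrec.snd) (Primrec.const _))
        exact this.not.computablePred.to_re
      stem := fun j t => if j = i ∧ t = s then c.stem i s ∪ F else c.stem j t
      -- All later elements exceed `m`, so the segment of length `m` is exactly `τ`.
      bound := max c.bound m
      mem_stem := by
        intro j t x hx
        split_ifs at hx with h
        · obtain ⟨rfl, rfl⟩ := h
          rcases Finset.mem_union.1 hx with hx | hx
          · exact c.mem_stem _ _ x hx
          · obtain ⟨hxm, hxτ⟩ := Finset.mem_filter.1 hx
            rcases (hadm' x (Finset.mem_range.1 hxm)).1 hxτ with h | ⟨-, -, h⟩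
            · exact c.mem_stem _ _ x h
            · rw [← h, boolInd_eq_true]
        · exact c.mem_stem _ _ x hx
      exists_mem := by
        refine ⟨X, fun n => ?_⟩
        rintro (h | h)
        · exact hX n h
        · simp [take_initSeg_min, min_comm] at h }
  have hdMem : ∀ X' : ℕ → Fin c.parts, d.Mem X' → c.Mem X' ∧ ∀ x < m, X' x = X x := by
    intro X' hX'
    refine ⟨fun n hn => hX' n (Or.inl hn), fun x hx => ?_⟩
    have := not_not.1 (not_or.1 (hX' m)).2
    simp only [take_initSeg_min, length_initSeg, min_self] at this
    exact eq_of_initSeg_eq this hx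
  have hext : d.Extends c id := by
    refine ⟨fun j t => ?_, ?_⟩
    · change c.stem j t ⊆ if j = i ∧ t = s then c.stem i s ∪ F else c.stem j t
      split_ifs with h
      · rw [h.1, h.2]
        exact Finset.subset_union_left
      · exact subset_rfl
    · rintro j t G ⟨X', hX', hsub, hG⟩
      change ↑(if j = i ∧ t = s then c.stem i s ∪ F else c.stem j t) ⊆ G at hsub
      change ∀ x ∈ G, x ∈ (if j = i ∧ t = s then c.stem i s ∪ F else c.stem j t) ∨
        (max c.bound m < x ∧ X' x = j) at hG
      obtain ⟨hX'c, hX'X⟩ := hdMem X' hX'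
      refine ⟨X', hX'c, ?_, fun x hx => ?_⟩
      · refine Set.Subset.trans (Finset.coe_subset.2 ?_) hsub
        change c.stem j t ⊆ _
        split_ifs with h
        · rw [h.1, h.2]
          exact Finset.subset_union_left
        · exact subset_rfl
      · change x ∈ c.stem j t ∨ c.bound < x ∧ X' x = j
        rcases hG x hx with h | ⟨h, h'⟩
        · split_ifs at h with hij
          · rw [hij.1, hij.2]
            rcases Finset.mem_union.1 h with h | h
            · exact Or.inl h
            · obtain ⟨hxm, hxτ⟩ := Finset.mem_filter.1 h
              have hxm := Finset.mem_range.1 hxm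
              rcases (hadm' x hxm).1 hxτ with h | ⟨h, h', -⟩
              · exact Or.inl h
              · exact Or.inr ⟨h, (hX'X x hxm).trans h'⟩
          · exact Or.inl h
        · exact Or.inr ⟨lt_of_le_of_lt (le_max_left _ _) h, h'⟩
  refine ⟨d, id, hext, U.erase i, Finset.card_erase_lt_of_mem hi, fun j hj => ?_⟩
  by_cases hji : j = i
  · subst j
    refine ⟨s, Or.inl ⟨b.1, b.2, m, hp b hb, fun G hG => ?_⟩⟩
    obtain ⟨X', hX', hsub, hG⟩ := hG
    have hst : d.stem i s = c.stem i s ∪ F := if_pos ⟨rfl, rfl⟩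
    rw [hst] at hsub hG
    have hτ : initSeg (boolInd G) m = τ := by
      rw [eq_initSeg_getD false τ, hlen]
      refine initSeg_congr fun x hx => ?_
      rw [Bool.eq_iff_iff, boolInd_eq_true]
      constructor
      · intro hxG
        rcases hG x hxG with h | ⟨h, -⟩
        · rcases Finset.mem_union.1 h with h | h
          · exact (hadm' x hx).2 h
          · exact (Finset.mem_filter.1 h).2
        · exact absurd (lt_of_le_of_lt (le_max_right c.bound m) h) (by omega)
      · intro h
        exact hsub (Finset.mem_coe.2 (Finset.mem_union_right _
          (Finset.mem_filter.2 ⟨Finset.mem_range.2 hx, h⟩)))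
    rw [hτ]
    exact hRb
  · exact hext.forces (hU j fun h => hj (Finset.mem_erase.2 ⟨hji, h⟩))

/-- Splitting all parts so that each of them has two incompatible valuations that cannot be met,
which forces divergence. -/
theorem exists_extends_of_not_found (c : Condition A C) {U : Finset (Fin c.parts)}
    {R : Bool → Requirement} (hR : ∀ s, REPred (R s)) {x : List ℕ}
    (hx : 2 * c.parts < 2 ^ x.length)
    (hW : ∀ p : List (ℕ × Bool), p.map Prod.fst = x → ∃ Y : ℕ → Fin c.parts × Bool, ∀ m,
      ¬ c.Found U R (initSeg (boolInd C) m, initSeg Y m, p))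
    (hU : ∀ i ∉ U, c.Forces V i R) :
    ∃ (d : Condition A C) (π : Fin d.parts → Fin c.parts), d.Extends c π ∧
      ∀ i, d.Forces V i R := by
  classical
  let B := Fin x.length → Bool
  let val : B → List (ℕ × Bool) := fun b => List.ofFn fun l => (x.get l, b l)
  have hval : ∀ b, (val b).map Prod.fst = x := by
    intro b
    simp only [val, List.map_ofFn]
    exact List.ofFn_get x
  choose Y hY using fun b => hW (val b) (hval b)
  -- A new colour records the colour and side given by all the counterexamples `Y b` at once.
  let e : (B → Fin c.parts × Bool) ≃ Fin (Fintype.card (B → Fin c.parts × Bool)) :=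
    Fintype.equivFin _
  let proj : B → Fin (Fintype.card (B → Fin c.parts × Bool)) → Fin c.parts × Bool :=
    fun b v => e.symm v b
  have hpigeon : ∀ v, ∃ b b', b ≠ b' ∧ proj b v = proj b' v := by
    intro v
    have hcard : Fintype.card (Fin c.parts × Bool) < Fintype.card B := by
      simpa [B, mul_comm] using hx
    exact Fintype.exists_ne_map_eq_of_card_lt (fun b => proj b v) hcard
  choose b₁ b₂ hne heq using hpigeon
  let π : Fin (Fintype.card (B → Fin c.parts × Bool)) → Fin c.parts := fun v => (proj (b₁ v) v).1
  let d : Condition A C :=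
    { parts := Fintype.card (B → Fin c.parts × Bool)
      rej := fun z => ∃ b, c.Found U R (z.1, z.2.map (proj b), val b)
      rePred_rej := REPred.exists_finite fun b => (c.rePred_found U hR).comp
        (Primrec.fst.pair ((Primrec.list_map Primrec.snd
          ((Primrec.dom_finite (proj b)).comp Primrec.snd).to₂).pair (Primrec.const (val b)))).to_comp
      stem := fun v => c.stem (π v)
      bound := c.bound
      mem_stem := fun v => c.mem_stem (π v)
      exists_mem := by
        refine ⟨fun x => e fun b => Y b x, fun m => ?_⟩
        rintro ⟨b, hb⟩
        rw [map_initSeg] at hb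
        have : (proj b ∘ fun x => e fun b => Y b x) = Y b := by
          funext x
          simp [proj]
        rw [this] at hb
        exact hY b m hb }
  have hdMem : ∀ X, d.Mem X → ∀ b m,
      ¬ c.Found U R (initSeg (boolInd C) m, initSeg (proj b ∘ X) m, val b) := by
    intro X hX b m hcon
    exact hX m ⟨b, by rwa [map_initSeg]⟩
  have hext : d.Extends c π := by
    refine ⟨fun _ _ => subset_rfl, ?_⟩
    rintro v s G ⟨X, hX, hsub, hG⟩
    -- Each projection of the superposed colouring lies in the class of `c`, as rejection is one of
    -- the ways to be `Found`.
    refine ⟨fun x => (proj (b₁ v) (X x)).1, fun m hm => ?_, hsub, fun x hx => ?_⟩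
    · refine hdMem X hX (b₁ v) m (Or.inl ?_)
      simp only [map_initSeg]
      exact hm
    · exact (hG x hx).imp_right fun h => ⟨h.1, by simp only [h.2, π]⟩
  refine ⟨d, π, hext, fun v => ?_⟩
  by_cases hv : π v ∈ U
  · obtain ⟨l, hl⟩ := Function.ne_iff.1 (hne v)
    -- Only the side on which the two valuations collide is handled. They take both Boolean values
    -- at index `l`, so no output remains at that argument.
    refine ⟨(proj (b₁ v) v).2, Or.inr ⟨x.get l, ?_⟩⟩
    rintro G ⟨X, hX, hsub, hG⟩ w m hRw
    have key : ∀ b : B, proj b v = proj (b₁ v) v → b l ≠ w := by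
      intro b hb hbw
      refine hdMem X hX b m (Or.inr ⟨proj (b₁ v) v, hv, initSeg (boolInd G) m, ⟨by simp, ?_⟩,
        (x.get l, w), ?_, hRw⟩)
      · refine admissible_initSeg hsub (fun x hx => ?_) m
        exact (hG x hx).imp_right fun h => ⟨h.1, by simp only [Function.comp, h.2, hb]⟩
      · exact List.mem_ofFn.2 ⟨l, by rw [hbw]⟩
    have hbool : ∀ a b w : Bool, a ≠ b → a ≠ w → b ≠ w → False := by decide
    exact hbool _ _ w hl (key (b₁ v) rfl) (key (b₂ v) (heq v).symm)
  · exact hext.forces (hU (π v) hv)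

/-- Every condition can be extended so that all its parts satisfy a given pair of requirements. -/
theorem exists_extends_forces (hV : REPred fun x : ℕ × Bool => V x.1 x.2)
    (hC : ∀ f, ComputableFromSet C f → ¬ Avoids f V) (c : Condition A C) {R : Bool → Requirement}
    (hR : ∀ s, REPred (R s)) :
    ∃ (d : Condition A C) (π : Fin d.parts → Fin c.parts), d.Extends c π ∧
      ∀ i, d.Forces V i R := by
  -- Induction on the number of unsettled parts: agreement settles one more, divergence settles all
  -- the rest.
  suffices H : ∀ (n : ℕ) (c : Condition A C) (U : Finset (Fin c.parts)), U.card = n →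
      (∀ i ∉ U, c.Forces V i R) → ∃ (d : Condition A C) (π : Fin d.parts → Fin c.parts),
        d.Extends c π ∧ ∀ i, d.Forces V i R from
    H _ c Finset.univ rfl fun i hi => absurd (Finset.mem_univ i) hi
  intro n
  induction n using Nat.strong_induction_on with
  | _ n ih =>
    rintro c U rfl hU
    have hW := REIn.forall_colouring (C := C) (c.rePred_found U hR)
    rcases exists_correct_or_forall_not_mem hV hC (2 * c.parts) hW with
      ⟨p, hpW, hp⟩ | ⟨x, hx, hxW⟩
    · obtain ⟨d, π, hd, U', hcard, hU'⟩ := c.exists_extends_of_found hp hpW hU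
      obtain ⟨e, π', he, hforces⟩ := ih _ hcard d U' rfl hU'
      exact ⟨e, _, he.trans hd, hforces⟩
    -- With K = `2 * c.parts` arguments the valuations outnumber the pairs of a part and a side.
    · refine c.exists_extends_of_not_found hR (x := x) (by rw [hx]; exact Nat.lt_two_pow_self)
        (fun p hp => ?_) hU
      have := hxW p hp
      push Not at this
      exact this

end Condition

/-! ### König's lemma. -/

theorem Finite.exists_forall_of_antitone {ι : Type*} [Finite ι] {Q : ℕ → ι → Prop}
    (hQ : ∀ m i, Q (m + 1) i → Q m i) (hex : ∀ m, ∃ i, Q m i) : ∃ i, ∀ m, Q m i := by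
  have hanti : ∀ i m n, m ≤ n → Q n i → Q m i := by
    intro i m n hmn
    induction n, hmn using Nat.le_induction with
    | base => exact id
    | succ n _ ih => exact fun h => ih (hQ n i h)
  by_contra hcon
  push Not at hcon
  choose g hg using hcon
  obtain ⟨N, hN⟩ := Set.Finite.bddAbove (Set.finite_range g)
  obtain ⟨i, hi⟩ := hex N
  exact hg i (hanti i _ _ (hN ⟨i, rfl⟩) hi)

/-- König's lemma for a predicate on an inverse sequence of finite types. -/
theorem exists_thread_of_finite {κ : ℕ → Type*} [∀ n, Finite (κ n)] (π : ∀ n, κ (n + 1) → κ n)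
    {P : ∀ n, κ n → Prop} (hP : ∀ n j, P (n + 1) j → P n (π n j)) (hex : ∀ n, ∃ i, P n i) :
    ∃ f : ∀ n, κ n, ∀ n, π n (f (n + 1)) = f n ∧ P n (f n) := by
  -- `Reach m n i` says that `i` has a descendant satisfying `P` exactly `m` levels later; the
  -- thread keeps to points reaching every level.
  let Reach : ℕ → ∀ n, κ n → Prop := fun m =>
    m.rec P fun _ r n i => ∃ j, π n j = i ∧ r (n + 1) j
  have hsucc : ∀ m n i, Reach (m + 1) n i ↔ ∃ j, π n j = i ∧ Reach m (n + 1) j :=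
    fun _ _ _ => Iff.rfl
  have hmono : ∀ m n i, Reach (m + 1) n i → Reach m n i := by
    intro m
    induction m with
    | zero =>
      rintro n _ ⟨j, rfl, hj⟩
      exact hP n j hj
    | succ m ih =>
      rintro n i ⟨j, hji, hj⟩
      exact ⟨j, hji, ih (n + 1) j hj⟩
  have hreach : ∀ m n, ∃ i, Reach m n i := by
    intro m
    induction m with
    | zero => exact hex
    | succ m ih =>
      intro n
      obtain ⟨j, hj⟩ := ih (n + 1)
      exact ⟨π n j, j, rfl, hj⟩
  have hnext : ∀ n (i : {i : κ n // ∀ m, Reach m n i}),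
      ∃ j : {j : κ (n + 1) // ∀ m, Reach m (n + 1) j}, π n j = i := by
    rintro n ⟨i, hi⟩
    obtain ⟨j, hj⟩ := Finite.exists_forall_of_antitone
      (Q := fun m j => π n j = i ∧ Reach m (n + 1) j)
      (fun m j h => ⟨h.1, hmono m _ _ h.2⟩) (fun m => (hsucc m n i).1 (hi (m + 1)))
    exact ⟨⟨j, fun m => (hj m).2⟩, (hj 0).1⟩
  choose next hnextπ using hnext
  obtain ⟨i₀, hi₀⟩ := Finite.exists_forall_of_antitone
    (fun m i => hmono m 0 i) fun m => hreach m 0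
  let f : ∀ n, {i : κ n // ∀ m, Reach m n i} := fun n => n.rec ⟨i₀, hi₀⟩ next
  exact ⟨fun n => (f n).1, fun n => ⟨hnextπ n (f n), (f n).2 0⟩⟩

/-! ### Parts that can be infinite. -/

namespace Condition

variable {A C : Set ℕ}

/-- Some colouring in the class of `c` uses the colour `i` infinitely often. -/
def Alive (c : Condition A C) (i : Fin c.parts) : Prop :=
  ∃ X, c.Mem X ∧ {x | X x = i}.Infinite

/-- Stems are finite and both sides share the colouring, so `s` is arbitrary; in terms of `Gen`,
aliveness passes along `Extends`. -/
theorem alive_iff {c : Condition A C} {i : Fin c.parts} (s : Bool) :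
    c.Alive i ↔ ∃ G : Set ℕ, G.Infinite ∧ c.Gen i s G := by
  constructor
  · rintro ⟨X, hX, hinf⟩
    refine ⟨↑(c.stem i s) ∪ {x | c.bound < x ∧ X x = i}, ?_, X, hX, Set.subset_union_left,
      fun x hx => hx.imp_left Finset.mem_coe.1⟩
    refine ((hinf.sdiff (Set.finite_Iic c.bound)).mono fun x hx => ?_)
    exact Or.inr ⟨not_le.1 hx.2, hx.1⟩
  · rintro ⟨G, hinf, X, hX, -, hG⟩
    refine ⟨X, hX, (hinf.sdiff (c.stem i s).finite_toSet).mono fun x hx => ?_⟩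
    exact ((hG x hx.1).resolve_left hx.2).2

theorem exists_alive (c : Condition A C) : ∃ i, c.Alive i := by
  obtain ⟨X, hX⟩ := c.exists_mem
  obtain ⟨i, hi⟩ := Finite.exists_infinite_fiber X
  exact ⟨i, X, hX, Set.infinite_coe_iff.1 hi⟩

theorem Extends.alive {d c : Condition A C} {π : Fin d.parts → Fin c.parts} (h : d.Extends c π)
    {i : Fin d.parts} (hi : d.Alive i) : c.Alive (π i) := by
  obtain ⟨G, hG, hgen⟩ := (alive_iff true).1 hi
  exact (alive_iff true).2 ⟨G, hG, h.gen i true G hgen⟩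

theorem gen_stem (c : Condition A C) (i : Fin c.parts) (s : Bool) : c.Gen i s ↑(c.stem i s) := by
  obtain ⟨X, hX⟩ := c.exists_mem
  exact ⟨X, hX, subset_rfl, fun x hx => Or.inl (Finset.mem_coe.1 hx)⟩

/-- The condition with a single part and empty stems. -/
def trivialCondition (A C : Set ℕ) : Condition A C where
  parts := 1
  rej := fun _ => False
  rePred_rej := REPred.const_false
  stem := fun _ _ => ∅
  bound := 0
  mem_stem := by simp
  exists_mem := ⟨fun _ => 0, fun _ h => h⟩

end Condition

/-! ### Construction of the generic set. -/

/-- The requirement that `G` has an element that is at least `j`. -/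
def hasElementGE (j : ℕ) : Requirement := fun z => ∃ x, j ≤ x ∧ z.1[x]? = some true

theorem rePred_hasElementGE (j : ℕ) : REPred (hasElementGE j) := by
  refine REPred.exists_snd (p := fun (z : List Bool × List Bool × ℕ × Bool) (x : ℕ) =>
    j ≤ x ∧ z.1[x]? = some true) ?_
  have h1 : PrimrecPred fun w : (List Bool × List Bool × ℕ × Bool) × ℕ => j ≤ w.2 :=
    Primrec.nat_le.comp (Primrec.const j) Primrec.snd
  have h2 : PrimrecPred fun w : (List Bool × List Bool × ℕ × Bool) × ℕ =>
      w.1.1[w.2]? = some true :=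
    Primrec.eq.comp (Primrec.list_getElem?.comp (Primrec.fst.comp Primrec.fst) Primrec.snd)
      (Primrec.const _)
  exact (h1.and h2).computablePred.to_re

theorem hasElementGE_initSeg {j m n : ℕ} {v : Bool} {G : Set ℕ} {γ : List Bool} :
    hasElementGE j (initSeg (boolInd G) m, γ, n, v) ↔ ∃ x ∈ G, j ≤ x ∧ x < m := by
  unfold hasElementGE
  refine exists_congr fun x => ?_
  rw [getElem?_initSeg]
  split_ifs with h <;> simp [h, and_comm]

theorem exists_initSeg_iUnion_eq {S : ℕ → Set ℕ} (hS : Monotone S) (m : ℕ) :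
    ∃ N, ∀ n, N ≤ n → initSeg (boolInd (⋃ k, S k)) m = initSeg (boolInd (S n)) m := by
  induction m with
  | zero => exact ⟨0, fun _ _ => rfl⟩
  | succ m ih =>
    obtain ⟨N, hN⟩ := ih
    have : ∃ N', ∀ n, N' ≤ n → boolInd (⋃ k, S k) m = boolInd (S n) m := by
      by_cases hm : m ∈ ⋃ k, S k
      · obtain ⟨k, hk⟩ := Set.mem_iUnion.1 hm
        refine ⟨k, fun n hn => ?_⟩
        rw [boolInd_eq_true.2 hm, boolInd_eq_true.2 (hS hn hk)]
      · refine ⟨0, fun n _ => ?_⟩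
        have hn : m ∉ S n := fun h => hm (Set.mem_iUnion.2 ⟨n, h⟩)
        rw [Bool.eq_iff_iff, boolInd_eq_true, boolInd_eq_true]
        exact iff_of_false hm hn
    obtain ⟨N', hN'⟩ := this
    refine ⟨max N N', fun n hn => ?_⟩
    rw [initSeg_succ, initSeg_succ, hN n (le_trans (le_max_left _ _) hn),
      hN' n (le_trans (le_max_right _ _) hn)]

theorem theorem1p4 (C A : Set ℕ) (hC : ¬ IsOfPADegree C) :
    ∃ G : Set ℕ, G.Infinite ∧ (G ⊆ A ∨ G ⊆ Aᶜ) ∧ ¬ IsOfPADegree (setJoin G C) := by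
  obtain ⟨V, hV, hCV⟩ := exists_graph_of_not_isOfPADegree hC
  have := REPred.countable (α := List Bool × List Bool × ℕ × Bool)
  let Req := {p : List Bool × List Bool × ℕ × Bool → Prop // REPred p}
  have : Nonempty (Bool → Req) := ⟨fun _ => ⟨_, REPred.const_false⟩⟩
  obtain ⟨R, hR⟩ := exists_surjective_nat (Bool → Req)
  choose D π hext hforces using fun (c : Condition A C) (n : ℕ) =>
    c.exists_extends_forces hV.rePred hCV (R := fun s => (R n s).1) fun s => (R n s).2
  let c : ℕ → Condition A C := fun n => n.rec (Condition.trivialCondition A C) fun n c => D c n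
  have hcext : ∀ n, (c (n + 1)).Extends (c n) (π (c n) n) := fun n => hext (c n) n
  obtain ⟨f, hf⟩ := exists_thread_of_finite (κ := fun n => Fin (c n).parts)
    (fun n => π (c n) n) (P := fun n i => (c n).Alive i) (fun n _ h => (hcext n).alive h)
    fun n => (c n).exists_alive
  let S : Bool → ℕ → Set ℕ := fun s n => ↑((c n).stem (f n) s)
  have hSmono : ∀ s, Monotone (S s) := fun s => monotone_nat_of_le_succ fun n => by
    have := (hcext n).stem_subset (f (n + 1)) s
    rw [(hf n).1] at this
    exact Finset.coe_subset.2 this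
  have hgen : ∀ s k n, k ≤ n → (c k).Gen (f k) s (S s n) := by
    intro s k n hkn
    suffices H : ∀ G, (c n).Gen (f n) s G → (c k).Gen (f k) s G from H _ ((c n).gen_stem _ s)
    induction n, hkn using Nat.le_induction with
    | base => exact fun _ h => h
    | succ n _ ih =>
      intro G hG
      have := (hcext n).gen _ s G hG
      rw [(hf n).1] at this
      exact ih G this
  let G : Bool → Set ℕ := fun s => ⋃ n, S s n
  -- The limit itself is not shown to satisfy `Gen`. Its finite stems do, and they suffice because
  -- forced facts concern finite segments.
  have hlim : ∀ s k m, ∃ n, initSeg (boolInd (G s)) m = initSeg (boolInd (S s n)) m ∧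
      (c k).Gen (f k) s (S s n) := by
    intro s k m
    obtain ⟨N, hN⟩ := exists_initSeg_iUnion_eq (hSmono s) m
    exact ⟨max N k, hN _ (le_max_left _ _), hgen s k _ (le_max_right _ _)⟩
  let Sat : Bool → Requirement → Prop := fun s r =>
    ∃ k, (c k).ForcesAgreement V (f k) s r ∨ (c k).ForcesDivergence (f k) s r
  have hSat : ∃ s, ∀ r, REPred r → Sat s r := by
    by_contra hcon
    push Not at hcon
    choose r hr hrs using hcon
    -- One failed requirement per side gives a pair that was treated at stage `n`.
    obtain ⟨n, hn⟩ := hR fun s => ⟨r s, hr s⟩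
    obtain ⟨s, hs⟩ := hforces (c n) n (f (n + 1))
    simp only [hn] at hs
    exact hrs s ⟨n + 1, hs⟩
  obtain ⟨s, hs⟩ := hSat
  refine ⟨G s, ?_, ?_, fun hPA => ?_⟩
  · refine Set.infinite_of_forall_exists_gt fun j => ?_
    obtain ⟨k, ⟨n, v, m, -, h⟩ | ⟨n, h⟩⟩ := hs _ (rePred_hasElementGE (j + 1))
    · obtain ⟨N, -, hgN⟩ := hlim s k m
      obtain ⟨x, hx, hjx, -⟩ := hasElementGE_initSeg.1 (h _ hgN)
      exact ⟨x, Set.mem_iUnion.2 ⟨N, hx⟩, hjx⟩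
    -- Divergence is impossible here: the part is alive, so some infinite set satisfies `Gen`.
    · obtain ⟨H, hH, hHgen⟩ := (Condition.alive_iff s).1 (hf k).2
      obtain ⟨x, hx, hjx⟩ := hH.exists_gt j
      exact absurd (hasElementGE_initSeg.2 ⟨x, hx, hjx, Nat.lt_succ_self x⟩)
        (h H hHgen true (x + 1))
  · cases s with
    | true =>
      refine Or.inl fun x hx => ?_
      obtain ⟨n, hn⟩ := Set.mem_iUnion.1 hx
      exact ((c n).mem_stem _ _ x hn).2 rfl
    | false =>
      refine Or.inr fun x hx hxA => ?_
      obtain ⟨n, hn⟩ := Set.mem_iUnion.1 hx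
      exact Bool.noConfusion (((c n).mem_stem _ _ x hn).1 hxA)
  · obtain ⟨g, hg, hgV⟩ := hPA.exists_avoids hV
    obtain ⟨r, hr, hgr⟩ := hg.exists_rePred
    -- Agreement contradicts avoidance of `V`; divergence contradicts totality of `g`.
    obtain ⟨k, ⟨n, v, m, hnv, h⟩ | ⟨n, h⟩⟩ := hs r hr
    · obtain ⟨N, hN, hgN⟩ := hlim s k m
      have := h _ hgN
      rw [← hN] at this
      exact hgV n ((hgr n v).2 ⟨m, this⟩ ▸ hnv)
    · obtain ⟨m, hm⟩ := (hgr n (g n)).1 rfl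
      obtain ⟨N, hN, hgN⟩ := hlim s k m
      rw [hN] at hm
      exact h _ hgN _ _ hm
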